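/- Let $d \ge 3$ and $k \ge 0$ be integers. Then there exists a $d$-regular treeing $\mathcal{T}$ such that the vector space of circulations in $L^2\big(E(\mathcal{T}),\eta\big)$ has dimension exactly $k$. Here a graphing is a graph whose vertex set is a standard Borel probability space $(X,\lambda)$ and whose edge set $E \subseteq X \times X$ (each edge being counted in both directions) is a countable union of graphs of measure preserving partial injections between Borel subsets of $X$. It is $d$-regular if every vertex has exactly $d$ neighbours, and it is a treeing if $\lambda$-almost every vertex lies on no cycle. The edge measure of a $d$-regular graphing is the probability measure $\eta(S) = \frac1d \int_X \deg_S(x)\, d\lambda(x)$ for Borel $S \subseteq E$, where $\deg_S(x) = |\{y : (x,y) \in S\}|$. A circulation is a function $f : E \to \mathbb{R}$ with $f(y,x) = -f(x,y)$ for every edge $(x,y)$ and $\sum_{y : (x,y)\in E} f(x,y) = 0$ for every vertex $x$; the space in question consists of the classes in $L^2(E,\eta)$ that contain a circulation. -/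

import Mathlib

open MeasureTheory Set
open scoped ENNReal

/-- `φ`, restricted to the Borel set `A`, is a measure preserving partial injection of
`(X, μ)`. -/
structure IsPartialPMP {X : Type*} [MeasurableSpace X] (μ : Measure X) (A : Set X)
    (φ : X → X) : Prop where
  measurableSet_dom : MeasurableSet A
  measurable : Measurable φ
  injOn : InjOn φ A
  measure_image : ∀ S : Set X, S ⊆ A → MeasurableSet S → μ (φ '' S) = μ S

/-- A graphing on the standard Borel space `X`: a probability measure and a simple graph on `X`
whose (symmetric) edge set is a countable union of graphs of measure preserving partial
injections. -/
structure Graphing (X : Type*) [MeasurableSpace X] [StandardBorelSpace X] where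
  graph : SimpleGraph X
  vertexMeasure : Measure X
  isProbabilityMeasure : IsProbabilityMeasure vertexMeasure
  exists_pmp : ∃ (A : ℕ → Set X) (φ : ℕ → X → X),
    (∀ n, IsPartialPMP vertexMeasure (A n) (φ n)) ∧
      ∀ x y, graph.Adj x y ↔ ∃ n, x ∈ A n ∧ φ n x = y

namespace Graphing

variable {X : Type*} [MeasurableSpace X] [StandardBorelSpace X]

/-- Every vertex has exactly `d` neighbours. -/
def IsRegular (T : Graphing X) (d : ℕ) : Prop :=
  ∀ x, (T.graph.neighborSet x).encard = d

/-- Essential acyclicity: almost every vertex lies on no cycle. -/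
def IsTreeing (T : Graphing X) : Prop :=
  ∀ᵐ x ∂T.vertexMeasure, ∀ c : T.graph.Walk x x, ¬ c.IsCycle

/-- The number of edges of `S` starting at `x`. -/
noncomputable def degIn (T : Graphing X) (S : Set (X × X)) (x : X) : ℝ≥0∞ :=
  (({y | T.graph.Adj x y ∧ (x, y) ∈ S}.encard : ℕ∞) : ℝ≥0∞)

theorem encard_eq_tsum_indicator {α : Type*} (s : Set α) :
    ((s.encard : ℕ∞) : ℝ≥0∞) = ∑' a, s.indicator (fun _ => (1 : ℝ≥0∞)) a := by
  rw [← tsum_subtype, ENNReal.tsum_set_one]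

theorem degIn_eq_tsum (T : Graphing X) (S : Set (X × X)) (x : X) :
    T.degIn S x
      = ∑' y, {y | T.graph.Adj x y ∧ (x, y) ∈ S}.indicator (fun _ => (1 : ℝ≥0∞)) y :=
  encard_eq_tsum_indicator _

theorem measurable_degIn (T : Graphing X) {S : Set (X × X)} (hS : MeasurableSet S) :
    Measurable (T.degIn S) := by
  classical
  obtain ⟨A, φ, hφ, hadj⟩ := T.exists_pmp
  let B : ℕ → Set X := fun n =>
    {x | x ∈ A n ∧ (x, φ n x) ∈ S ∧ ∀ m, m < n → ¬ (x ∈ A m ∧ φ m x = φ n x)}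
  have hB : ∀ n, MeasurableSet (B n) := by
    intro n
    refine (hφ n).measurableSet_dom.inter (MeasurableSet.inter ?_ ?_)
    · exact (measurable_id.prodMk (hφ n).measurable) hS
    · have : {x | ∀ m, m < n → ¬ (x ∈ A m ∧ φ m x = φ n x)}
          = ⋂ m, ⋂ (_ : m < n), (A m ∩ {x | φ m x = φ n x})ᶜ := by
        ext x; simp
      change MeasurableSet {x | ∀ m, m < n → ¬ (x ∈ A m ∧ φ m x = φ n x)}
      rw [this]
      let _ := upgradeStandardBorel X
      exact MeasurableSet.iInter fun m => MeasurableSet.iInter fun _ =>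
        ((hφ m).measurableSet_dom.inter
          (measurableSet_eq_fun (hφ m).measurable (hφ n).measurable)).compl
  have key : T.degIn S = fun x => ∑' n, (B n).indicator (fun _ => (1 : ℝ≥0∞)) x := by
    funext x
    have himg : {y | T.graph.Adj x y ∧ (x, y) ∈ S} = (fun n => φ n x) '' {n | x ∈ B n} := by
      ext y
      constructor
      · rintro ⟨h1, h2⟩
        have hex := (hadj x y).1 h1
        refine ⟨Nat.find hex, ⟨(Nat.find_spec hex).1, ?_, ?_⟩, (Nat.find_spec hex).2⟩
        · rw [(Nat.find_spec hex).2]; exact h2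
        · rintro m hm ⟨ha, hb⟩
          exact Nat.find_min hex hm ⟨ha, hb.trans (Nat.find_spec hex).2⟩
      · rintro ⟨n, ⟨h1, h2, -⟩, rfl⟩
        exact ⟨(hadj _ _).2 ⟨n, h1, rfl⟩, h2⟩
    have hinj : InjOn (fun n => φ n x) {n | x ∈ B n} := by
      intro m hm n hn h
      rcases lt_trichotomy m n with hlt | heq | hlt
      · exact absurd ⟨hm.1, h⟩ (hn.2.2 m hlt)
      · exact heq
      · exact absurd ⟨hn.1, h.symm⟩ (hm.2.2 n hlt)
    unfold degIn
    rw [himg, hinj.encard_image, encard_eq_tsum_indicator]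
    refine tsum_congr fun n => ?_
    by_cases h : x ∈ B n <;> simp [h]
  rw [key]
  exact Measurable.tsum fun n => measurable_const.indicator (hB n)

/-- The edge measure `η(S) = (1/d) ∫ deg_S(x) dμ(x)` of a `d`-regular graphing, as a measure on
ordered pairs of vertices; it is concentrated on the edges. -/
noncomputable def edgeMeasure (T : Graphing X) (d : ℕ) : Measure (X × X) :=
  (d : ℝ≥0∞)⁻¹ • Measure.ofMeasurable (fun S _ => ∫⁻ x, T.degIn S x ∂T.vertexMeasure)
    (by simp [degIn])
    (by
      intro S hS hd
      rw [← lintegral_tsum fun i => (T.measurable_degIn (hS i)).aemeasurable]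
      refine lintegral_congr fun x => ?_
      simp only [degIn_eq_tsum]
      rw [ENNReal.tsum_comm]
      refine tsum_congr fun y => ?_
      have hU : {y | T.graph.Adj x y ∧ (x, y) ∈ ⋃ i, S i}
          = ⋃ i, {y | T.graph.Adj x y ∧ (x, y) ∈ S i} := by
        ext z; simp
      rw [hU]
      by_cases h : ∃ i, y ∈ {y | T.graph.Adj x y ∧ (x, y) ∈ S i}
      · obtain ⟨i, hi⟩ := h
        rw [indicator_of_mem (mem_iUnion.2 ⟨i, hi⟩), tsum_eq_single i, indicator_of_mem hi]
        intro j hj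
        exact indicator_of_notMem
          (fun h' => Set.disjoint_left.1 (hd hj) h'.2 hi.2) _
      · rw [indicator_of_notMem (fun h' => h (mem_iUnion.1 h')), eq_comm, ENNReal.tsum_eq_zero]
        exact fun i => indicator_of_notMem (fun h' => h ⟨i, h'⟩) _)

/-- A circulation on a graph: a function on directed edges that is antisymmetric and whose values
on the edges starting at any given vertex sum to zero. (The values of `f` off the edges are
irrelevant; on a locally finite graph `HasSum` is a finite sum.) -/
structure IsCirculation {V : Type*} (G : SimpleGraph V) (f : V → V → ℝ) : Prop where
  antisymm : ∀ x y, G.Adj x y → f y x = -f x y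
  flow : ∀ x, HasSum (fun y : G.neighborSet x => f x y) 0

/-- The space of circulations in `L²(E, η)`: the `η`-classes of square integrable functions that
contain a circulation. -/
noncomputable def circulations (T : Graphing X) (d : ℕ) :
    Submodule ℝ (Lp ℝ 2 (T.edgeMeasure d)) where
  carrier := {u | ∃ f : X → X → ℝ, IsCirculation T.graph f ∧
    u =ᵐ[T.edgeMeasure d] fun p => f p.1 p.2}
  zero_mem' := ⟨fun _ _ => 0, ⟨fun _ _ _ => by simp, fun _ => hasSum_zero⟩, Lp.coeFn_zero _ _ _⟩
  add_mem' := by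
    rintro u v ⟨f, hf, hu⟩ ⟨g, hg, hv⟩
    refine ⟨fun x y => f x y + g x y, ⟨fun x y h => ?_, fun x => ?_⟩, ?_⟩
    · rw [hf.antisymm x y h, hg.antisymm x y h]; ring
    · simpa using (hf.flow x).add (hg.flow x)
    · filter_upwards [Lp.coeFn_add u v, hu, hv] with p h1 h2 h3
      rw [h1, Pi.add_apply, h2, h3]
  smul_mem' := by
    rintro c u ⟨f, hf, hu⟩
    refine ⟨fun x y => c * f x y, ⟨fun x y h => ?_, fun x => ?_⟩, ?_⟩
    · rw [hf.antisymm x y h]; ring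
    · simpa using (hf.flow x).mul_left c
    · filter_upwards [Lp.coeFn_smul c u, hu] with p h1 h2
      rw [h1, Pi.smul_apply, h2, smul_eq_mul]

end Graphing

/-! A vertex is a label together with a digit sequence, under the uniform measure, and its `d`
neighbours are its images under `d` measure preserving involutions, the colors. Colors 0 and 1,
`revMap` and `negMap`, act on mixed radix numbers as `y ↦ -1 - y` and `y ↦ -y`. Their composition is
an odometer, so almost surely they trace out two-way infinite lines. They also exchange the labels
`(j, true)` and `(j, false)` for `j ≠ 0`, which orients the lines over these labels measurably: a
constant flow along them gives one parameter for each of the `k` nonzero `j`. Labels with `j = 0`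
are fixed, and there ergodicity of the odometer rules out a measurable orientation, hence any flow.

The remaining colors must make the degree `d` without carrying flow. The tent functions `height n`
serve as potentials: an integrable circulation does no total work against them
(`sum_integral_height_sub_mul`). A schedule `e` assigns to `n` a color `i ≥ 2` and a cylinder `A`,
and color `i` is built so that, off a set of small measure, `height n` increases from `x` to its
partner by the indicator of `A` at `x` minus that at the partner. All other colors preserve `height
n`, except that `negMap` changes it by at most one on the points whose first `n` digits vanish. The
work along color `i` is thus close to twice the integral of the flow over `A`. As each color and
cylinder recur in the schedule, these integrals vanish, and so does the flow
(`ae_eq_zero_of_two_le`). What is left is reversed by both static involutions, hence invariant under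
the odometer and constant on each label (`ae_eq_label_of_neg`).

Color `i` is the limit of involutions `stage e i n` of the first `n` digits. Passing to stage `n +
1`, the digit `n` is shifted to produce the wanted increment. Where this would push it out of its
half, the point jumps: it is paired anew by reversing the digit `n` alone, which keeps the tent
function. Jumps have summable probabilities, so Borel–Cantelli gives a limit almost everywhere.

The same potentials give acyclicity. Around finitely many vertices, some `height n` changes along a
given edge of color at least 2 and along no other edge, so that edge is a bridge
(`isBridge_of_two_le`). The static edges are compared with finite paths (`isAcyclic_static`).
Restricting to the invariant conull `goodSet` makes the graph regular at every vertex. -/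

/-! ### Digit sequences -/

/-- The `n`-th digit. -/
abbrev Dig (n : ℕ) : Type := Fin (2 * 2 ^ n)

/-- The labels; the second component of a label is only relevant when the first is nonzero. -/
abbrev Label (k : ℕ) : Type := Fin (k + 1) × Bool

/-- The vertex space: a label together with a sequence of digits. -/
abbrev Space (k : ℕ) : Type := Label k × (∀ n, Dig n)

theorem two_mul_two_pow_pos (n : ℕ) : 0 < 2 * 2 ^ n := by positivity

instance (n : ℕ) : NeZero (2 * 2 ^ n) := ⟨(two_mul_two_pow_pos n).ne'⟩

/-- The number of digit strings of length `n`. -/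
def place : ℕ → ℕ
  | 0 => 1
  | n + 1 => place n * (2 * 2 ^ n)

theorem place_pos : ∀ n, 0 < place n
  | 0 => Nat.one_pos
  | n + 1 => Nat.mul_pos (place_pos n) (two_mul_two_pow_pos n)

/-- The number written by the first `n` digits. -/
def val (n : ℕ) (y : ∀ n, Dig n) : ℕ := ∑ m ∈ Finset.range n, (y m : ℕ) * place m

theorem val_succ (n : ℕ) (y : ∀ n, Dig n) : val (n + 1) y = val n y + (y n : ℕ) * place n :=
  Finset.sum_range_succ _ _

theorem val_lt (y : ∀ n, Dig n) : ∀ n, val n y < place n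
  | 0 => by simp [val, place]
  | n + 1 => by
    rw [val_succ, place]
    have h1 := val_lt y n
    have h2 : (y n : ℕ) + 1 ≤ 2 * 2 ^ n := (y n).isLt
    nlinarith [Nat.mul_le_mul_right (place n) h2]

theorem val_eq_iff {n : ℕ} {y z : ∀ n, Dig n} : val n y = val n z ↔ ∀ m < n, y m = z m := by
  induction n with
  | zero => simp [val]
  | succ n ih =>
    constructor
    · intro h
      rw [val_succ, val_succ] at h
      have hy := val_lt y n
      have hz := val_lt z n
      have h1 : (y n : ℕ) = z n := by
        have := congrArg (· / place n) h
        simpa [Nat.add_mul_div_right _ _ (place_pos n), Nat.div_eq_of_lt hy,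
          Nat.div_eq_of_lt hz] using this
      have h2 : val n y = val n z := by rw [h1] at h; omega
      intro m hm
      rcases Nat.lt_succ_iff_lt_or_eq.1 hm with hm | rfl
      · exact ih.1 h2 m hm
      · exact Fin.ext h1
    · intro h
      rw [val_succ, val_succ, ih.2 fun m hm => h m (hm.trans n.lt_succ_self),
        h n n.lt_succ_self]

/-! ### Cylinder sets and changes of a single digit. -/

section Space

variable {k : ℕ}

/-- The information in the label and the first `n` digits. -/
def code (n : ℕ) (x : Space k) : Label k × ℕ := (x.1, val n x.2)

theorem code_eq_iff {n : ℕ} {x z : Space k} :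
    code n x = code n z ↔ x.1 = z.1 ∧ ∀ m < n, x.2 m = z.2 m := by
  rw [code, code, Prod.mk.injEq, val_eq_iff]

theorem code_mono {m n : ℕ} (h : m ≤ n) {x z : Space k} (hx : code n x = code n z) :
    code m x = code m z := by
  rw [code_eq_iff] at hx ⊢
  exact ⟨hx.1, fun j hj => hx.2 j (hj.trans_le h)⟩

theorem eq_of_forall_code {x z : Space k} (N : ℕ) (h : ∀ n, N ≤ n → code n x = code n z) :
    x = z := by
  refine Prod.ext (code_eq_iff.1 (h N le_rfl)).1 (funext fun m => ?_)
  exact (code_eq_iff.1 (h (N + (m + 1)) (by omega))).2 m (by omega)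

theorem exists_code_ne {x z : Space k} (h : x ≠ z) : ∃ N, ∀ n, N ≤ n → code n x ≠ code n z := by
  by_contra! H
  refine h (eq_of_forall_code 0 fun n _ => ?_)
  obtain ⟨m, hm, h⟩ := H n
  exact code_mono hm h

theorem code_succ_eq_iff {n : ℕ} {x z : Space k} :
    code (n + 1) x = code (n + 1) z ↔ code n x = code n z ∧ x.2 n = z.2 n := by
  simp only [code_eq_iff, Nat.lt_succ_iff_lt_or_eq]
  constructor
  · exact fun h => ⟨⟨h.1, fun m hm => h.2 m (.inl hm)⟩, h.2 n (.inr rfl)⟩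
  · rintro ⟨⟨h1, h2⟩, h3⟩
    refine ⟨h1, fun m hm => ?_⟩
    rcases hm with hm | rfl
    exacts [h2 m hm, h3]

/-- Replace the `n`-th digit. -/
def setDigit (x : Space k) (n : ℕ) (m : Dig n) : Space k := (x.1, Function.update x.2 n m)

@[simp] theorem setDigit_fst (x : Space k) (n : ℕ) (m : Dig n) : (setDigit x n m).1 = x.1 := rfl

@[simp] theorem setDigit_snd_self (x : Space k) (n : ℕ) (m : Dig n) :
    (setDigit x n m).2 n = m := by simp [setDigit]

theorem setDigit_snd_of_ne (x : Space k) {n j : ℕ} (m : Dig n) (h : j ≠ n) :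
    (setDigit x n m).2 j = x.2 j := by simp [setDigit, h]

@[simp] theorem setDigit_setDigit (x : Space k) (n : ℕ) (m m' : Dig n) :
    setDigit (setDigit x n m) n m' = setDigit x n m' := by simp [setDigit]

@[simp] theorem setDigit_eq_self (x : Space k) (n : ℕ) : setDigit x n (x.2 n) = x := by
  simp [setDigit]

theorem code_setDigit (x : Space k) (n : ℕ) (m : Dig n) : code n (setDigit x n m) = code n x :=
  code_eq_iff.2 ⟨rfl, fun _ hj => setDigit_snd_of_ne _ _ hj.ne⟩

end Space

/-! ### The tent function and its shifts -/

/-- The distance of a digit to the nearer end of the range of digits. -/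
def tent {n : ℕ} (m : Dig n) : ℤ := if (m : ℕ) < 2 ^ n then m else 2 * 2 ^ n - 1 - m

/-- This symmetry is why jumps and both static involutions, all of which reverse digits, leave the
potentials alone. -/
theorem tent_rev {n : ℕ} (m : Dig n) : tent m.rev = tent m := by
  have := m.isLt
  unfold tent
  rw [Fin.val_rev]
  zify
  split_ifs <;> push_cast [Nat.cast_sub (show (m : ℕ) + 1 ≤ 2 * 2 ^ n from m.isLt)] at * <;> omega

/-- The position to which a digit moves when the tent function is to increase by `c`. -/
def shifted {n : ℕ} (c : ℤ) (m : Dig n) : ℤ := if (m : ℕ) < 2 ^ n then m + c else m - c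

/-- The digit can be moved, within its half, so that the tent function increases by `c`. -/
def Advances {n : ℕ} (c : ℤ) (m : Dig n) : Prop :=
  0 ≤ shifted c m ∧ shifted c m < 2 * 2 ^ n ∧ (shifted c m < 2 ^ n ↔ (m : ℕ) < 2 ^ n)

open Classical in
/-- Move the digit so that the tent function increases by `c`, if possible. -/
noncomputable def shift {n : ℕ} (c : ℤ) (m : Dig n) : Dig n :=
  if h : Advances c m then ⟨(shifted c m).toNat, by
    have h1 := h.1
    have h2 := h.2.1
    zify
    omega⟩ else m

theorem shift_val {n : ℕ} {c : ℤ} {m : Dig n} (h : Advances c m) :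
    ((shift c m : Dig n) : ℤ) = shifted c m := by
  rw [shift, dif_pos h]
  exact Int.toNat_of_nonneg h.1

theorem tent_shift {n : ℕ} {c : ℤ} {m : Dig n} (h : Advances c m) :
    tent (shift c m) = tent m + c := by
  have hv := shift_val h
  obtain ⟨h1, h2, h3⟩ := h
  unfold tent
  zify at *
  rw [hv]
  unfold shifted at *
  zify at *
  split_ifs at * <;> omega

theorem Advances.shift {n : ℕ} {c : ℤ} {m : Dig n} (h : Advances c m) :
    Advances (-c) (shift c m) := by
  have hv := shift_val h
  have := m.isLt
  obtain ⟨h1, h2, h3⟩ := h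
  unfold Advances shifted at *
  zify at *
  rw [hv]
  split_ifs at * <;> omega

theorem shift_shift {n : ℕ} {c : ℤ} {m : Dig n} (h : Advances c m) :
    shift (-c) (shift c m) = m := by
  have hv := shift_val h
  have hw := shift_val h.shift
  have := m.isLt
  apply Fin.ext
  zify
  rw [hw]
  obtain ⟨h1, h2, h3⟩ := h
  unfold shifted at *
  zify at *
  rw [hv]
  split_ifs at * <;> omega

/-- Reversal exchanges the two halves together with their directions of motion. It ensures that the
partner of a jumping point jumps too. -/
theorem advances_rev {n : ℕ} {c : ℤ} {m : Dig n} : Advances c m.rev ↔ Advances c m := by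
  have := m.isLt
  have hr : ((m.rev : Dig n) : ℤ) = 2 * 2 ^ n - 1 - m := by
    rw [Fin.val_rev, Nat.cast_sub (show (m : ℕ) + 1 ≤ 2 * 2 ^ n from m.isLt)]
    push_cast; ring
  unfold Advances shifted
  zify at *
  rw [hr]
  split_ifs at * <;> constructor <;> rintro ⟨h1, h2, h3⟩ <;> refine ⟨?_, ?_, ?_⟩ <;> omega

theorem advances_zero {n : ℕ} (m : Dig n) : Advances 0 m := by
  have := m.isLt
  unfold Advances shifted
  zify at *
  split_ifs at * <;> refine ⟨?_, ?_, ?_⟩ <;> omega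

/-- A single step leaves a half only from one of its ends. Only four of the `2 * 2 ^ n` digits are
therefore exceptional, which makes the jump probabilities summable. -/
theorem not_advances {n : ℕ} {c : ℤ} (hc : |c| ≤ 1) {m : Dig n} (h : ¬ Advances c m) :
    (m : ℕ) = 0 ∨ (m : ℕ) = 2 ^ n - 1 ∨ (m : ℕ) = 2 ^ n ∨ (m : ℕ) = 2 * 2 ^ n - 1 := by
  have := m.isLt
  have hp : 0 < 2 ^ n := by positivity
  have hc := abs_le.1 hc
  contrapose! h
  obtain ⟨h1, h2, h3, h4⟩ := h
  have h2' : (m : ℕ) + 1 ≠ 2 ^ n := by omega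
  have h4' : (m : ℕ) + 1 ≠ 2 * 2 ^ n := by omega
  clear h2 h4
  unfold Advances shifted
  zify at *
  split_ifs at * <;> refine ⟨?_, ?_, ?_⟩ <;> omega

theorem rev_ne {n : ℕ} (m : Dig n) : m.rev ≠ m := by
  intro h
  have := m.isLt
  have h := congrArg Fin.val h
  rw [Fin.val_rev] at h
  omega

/-! ### The limit involutions -/

section Limit

variable {k d : ℕ}

/-- The cylinder set treated at stage `n` of a schedule, if it is already visible there. -/
def target (e : ℕ → Fin d × ℕ × (Label k × ℕ)) (n : ℕ) : Set (Space k) :=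
  {x | (e n).2.1 ≤ n ∧ code (e n).2.1 x = (e n).2.2}

theorem mem_target_congr (e : ℕ → Fin d × ℕ × (Label k × ℕ)) {n : ℕ} {x z : Space k}
    (h : code n x = code n z) : x ∈ target e n ↔ z ∈ target e n := by
  simp only [target, mem_ofPred_eq]
  refine and_congr_right fun hn => ?_
  rw [code_mono hn h]

/-- The amount by which the `n`-th tent function is to increase from `x` to its partner `z`. -/
noncomputable def increment (e : ℕ → Fin d × ℕ × (Label k × ℕ)) (i : Fin d) (n : ℕ)
    (x z : Space k) : ℤ :=
  if (e n).1 = i then (target e n).indicator 1 x - (target e n).indicator 1 z else 0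

variable (e : ℕ → Fin d × ℕ × (Label k × ℕ)) (i : Fin d)

theorem increment_congr {n : ℕ} {x x' z z' : Space k} (hx : code n x = code n x')
    (hz : code n z = code n z') : increment e i n x z = increment e i n x' z' := by
  classical
  simp only [increment, indicator_apply, mem_target_congr e hx, mem_target_congr e hz,
    Pi.one_apply]

theorem increment_swap (n : ℕ) (x z : Space k) :
    increment e i n z x = -increment e i n x z := by
  unfold increment
  split_ifs <;> ring

theorem abs_increment_le (n : ℕ) (x z : Space k) : |increment e i n x z| ≤ 1 := by
  classical
  simp only [increment, indicator_apply]
  split_ifs <;> simp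

theorem increment_of_ne {n : ℕ} (h : (e n).1 ≠ i) (x z : Space k) : increment e i n x z = 0 :=
  if_neg h

open Classical in
/-- The involution of stage `n`, which only reads and modifies the first `n` digits. -/
noncomputable def stage : ℕ → Space k → Space k
  | 0 => id
  | n + 1 => fun x =>
    if n = 0 ∨ ¬ Advances (increment e i n x (stage n x)) (x.2 n) then
      setDigit x n (x.2 n).rev
    else setDigit (stage n x) n (shift (increment e i n x (stage n x)) (x.2 n))

/-- At the point `x`, the involution of stage `n + 1` does not extend that of stage `n`. -/
def Jumps (n : ℕ) (x : Space k) : Prop :=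
  n = 0 ∨ ¬ Advances (increment e i n x (stage e i n x)) (x.2 n)

theorem stage_succ_of_jumps {n : ℕ} {x : Space k} (h : Jumps e i n x) :
    stage e i (n + 1) x = setDigit x n (x.2 n).rev := if_pos h

theorem stage_succ_of_not_jumps {n : ℕ} {x : Space k} (h : ¬ Jumps e i n x) :
    stage e i (n + 1) x = setDigit (stage e i n x) n
      (shift (increment e i n x (stage e i n x)) (x.2 n)) := if_neg h

theorem stage_fst (n : ℕ) (x : Space k) : (stage e i n x).1 = x.1 := by
  induction n with
  | zero => rfl
  | succ n ih =>
    by_cases h : Jumps e i n x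
    · rw [stage_succ_of_jumps e i h, setDigit_fst]
    · rw [stage_succ_of_not_jumps e i h, setDigit_fst, ih]

theorem stage_snd {n j : ℕ} (hj : n ≤ j) (x : Space k) : (stage e i n x).2 j = x.2 j := by
  induction n with
  | zero => rfl
  | succ n ih =>
    by_cases h : Jumps e i n x
    · rw [stage_succ_of_jumps e i h, setDigit_snd_of_ne _ _ (by omega)]
    · rw [stage_succ_of_not_jumps e i h, setDigit_snd_of_ne _ _ (by omega), ih (by omega)]

theorem code_stage_congr {n : ℕ} {x z : Space k} (h : code n x = code n z) :
    code n (stage e i n x) = code n (stage e i n z) := by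
  induction n with
  | zero => exact h
  | succ n ih =>
    have hn := code_mono n.le_succ h
    have hd : x.2 n = z.2 n := (code_succ_eq_iff.1 h).2
    have hi := increment_congr e i hn (ih hn)
    have hj : Jumps e i n x ↔ Jumps e i n z := by rw [Jumps, Jumps, hi, hd]
    rw [code_succ_eq_iff]
    by_cases hx : Jumps e i n x
    · rw [stage_succ_of_jumps e i hx, stage_succ_of_jumps e i (hj.1 hx), code_setDigit,
        code_setDigit, setDigit_snd_self, setDigit_snd_self, hd]
      exact ⟨hn, rfl⟩
    · rw [stage_succ_of_not_jumps e i hx, stage_succ_of_not_jumps e i (mt hj.2 hx),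
        code_setDigit, code_setDigit, setDigit_snd_self, setDigit_snd_self, hi, hd]
      exact ⟨ih hn, rfl⟩

theorem code_stage_congr_of_le {n m : ℕ} (hm : n ≤ m) {x z : Space k}
    (h : code m x = code m z) : code m (stage e i n x) = code m (stage e i n z) := by
  have h1 := code_stage_congr e i (code_mono hm h)
  rw [code_eq_iff] at h h1 ⊢
  refine ⟨h1.1, fun j hj => ?_⟩
  rcases lt_or_ge j n with hn | hn
  · exact h1.2 j hn
  · rw [stage_snd e i hn, stage_snd e i hn, h.2 j hj]

theorem jumps_congr {n : ℕ} {x z : Space k} (h : code (n + 1) x = code (n + 1) z) :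
    Jumps e i n x ↔ Jumps e i n z := by
  rw [code_succ_eq_iff] at h
  rw [Jumps, Jumps, increment_congr e i h.1 (code_stage_congr e i h.1), h.2]

theorem stage_setDigit (n : ℕ) (x : Space k) (m : Dig n) :
    stage e i n (setDigit x n m) = setDigit (stage e i n x) n m := by
  refine eq_of_forall_code (n + 1) fun j hj => ?_
  have h1 : code n (stage e i n (setDigit x n m)) = code n (setDigit (stage e i n x) n m) := by
    rw [code_stage_congr e i (code_setDigit x n m), code_setDigit]
  rw [code_eq_iff] at h1 ⊢
  refine ⟨h1.1, fun l _ => ?_⟩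
  rcases lt_trichotomy l n with hl | rfl | hl
  · exact h1.2 l hl
  · rw [stage_snd e i le_rfl, setDigit_snd_self, setDigit_snd_self]
  · rw [stage_snd e i hl.le, setDigit_snd_of_ne _ _ hl.ne', setDigit_snd_of_ne _ _ hl.ne',
      stage_snd e i hl.le]

/-- The partner of a jumping point jumps back. At the partner of any other point the increment has
the opposite sign, the reverse shift is possible by `Advances.shift`, and the two shifts cancel. -/
theorem stage_stage (n : ℕ) (x : Space k) : stage e i n (stage e i n x) = x := by
  induction n generalizing x with
  | zero => rfl
  | succ n ih =>
    by_cases h : Jumps e i n x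
    · rw [stage_succ_of_jumps e i h]
      have h' : Jumps e i n (setDigit x n (x.2 n).rev) := by
        unfold Jumps at h ⊢
        rwa [increment_congr e i (code_setDigit _ _ _)
          (code_stage_congr e i (code_setDigit _ _ _)), setDigit_snd_self, advances_rev]
      rw [stage_succ_of_jumps e i h', setDigit_snd_self, Fin.rev_rev, setDigit_setDigit,
        setDigit_eq_self]
    · rw [stage_succ_of_not_jumps e i h]
      set c := increment e i n x (stage e i n x) with hc
      have hs : stage e i n (setDigit (stage e i n x) n (shift c (x.2 n))) =
          setDigit x n (shift c (x.2 n)) := by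
        rw [stage_setDigit, ih]
      have hi : increment e i n (setDigit (stage e i n x) n (shift c (x.2 n)))
          (setDigit x n (shift c (x.2 n))) = -c := by
        rw [increment_congr e i (code_setDigit _ _ _) (code_setDigit _ _ _), increment_swap]
      have hcx : n ≠ 0 ∧ Advances c (x.2 n) := by
        unfold Jumps at h
        push Not at h
        exact h
      have h' : ¬ Jumps e i n (setDigit (stage e i n x) n (shift c (x.2 n))) := by
        unfold Jumps
        rw [hs, hi, setDigit_snd_self]
        push Not
        exact ⟨hcx.1, hcx.2.shift⟩
      rw [stage_succ_of_not_jumps e i h', hs, hi, setDigit_snd_self, setDigit_setDigit,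
        shift_shift hcx.2, setDigit_eq_self]

/-- Digit 0 always jumps, and reversal has no fixed digit because the number of digits is even. A
later stage either keeps the earlier difference or creates one by a jump. -/
theorem code_stage_ne {n : ℕ} (hn : 0 < n) (x : Space k) : code n (stage e i n x) ≠ code n x := by
  induction n, hn using Nat.le_induction with
  | base =>
    rw [stage_succ_of_jumps e i (.inl rfl)]
    intro h
    have := (code_succ_eq_iff.1 h).2
    rw [setDigit_snd_self] at this
    exact rev_ne _ this
  | succ n _ ih =>
    intro h
    rw [code_succ_eq_iff] at h
    by_cases hj : Jumps e i n x
    · rw [stage_succ_of_jumps e i hj, setDigit_snd_self] at h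
      exact rev_ne _ h.2
    · rw [stage_succ_of_not_jumps e i hj, code_setDigit] at h
      exact ih h.1

-- A jump at stage `m` discards all earlier changes to the digits below `m`, and nothing else
-- touches them. So digit `j` is either restored or stays as stage `j + 1` left it.
open Classical in
theorem stage_snd_eq_ite {j n : ℕ} (hj : j < n) (x : Space k) :
    (stage e i n x).2 j =
      if ∃ m, j < m ∧ m < n ∧ Jumps e i m x then x.2 j else (stage e i (j + 1) x).2 j := by
  induction n, hj using Nat.le_induction with
  | base => rw [if_neg]; rintro ⟨m, h1, h2, -⟩; omega
  | succ n hn ih =>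
    have hne : j ≠ n := by omega
    by_cases h : Jumps e i n x
    · rw [stage_succ_of_jumps e i h, setDigit_snd_of_ne _ _ hne,
        if_pos ⟨n, by omega, by omega, h⟩]
    · rw [stage_succ_of_not_jumps e i h, setDigit_snd_of_ne _ _ hne, ih]
      congr 1
      refine propext (exists_congr fun m => and_congr_right fun _ => ?_)
      constructor
      · exact fun h' => ⟨by omega, h'.2⟩
      · rintro ⟨h1, h2⟩
        refine ⟨?_, h2⟩
        rcases Nat.lt_succ_iff_lt_or_eq.1 h1 with h1 | rfl
        · exact h1
        · exact absurd h2 h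

open Classical in
/-- The limit of the involutions `stage e i n`. -/
noncomputable def limitMap (x : Space k) : Space k :=
  (x.1, fun j => if ∃ m, j < m ∧ Jumps e i m x then x.2 j else (stage e i (j + 1) x).2 j)

theorem code_limitMap {n : ℕ} {x : Space k} (h : ∀ m, n ≤ m → ¬ Jumps e i m x) :
    code n (limitMap e i x) = code n (stage e i n x) := by
  classical
  refine code_eq_iff.2 ⟨(stage_fst e i n x).symm, fun j hj => ?_⟩
  rw [stage_snd_eq_ite e i hj]
  simp only [limitMap]
  congr 1
  refine propext (exists_congr fun m => and_congr_right fun _ => ?_)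
  constructor
  · exact fun h' => ⟨lt_of_not_ge fun hm => h m hm h', h'⟩
  · exact And.right

/-- At each later stage the partner sees the opposite increment, and the shift it has to make merely
undoes a possible one. -/
theorem jumps_limitMap {n : ℕ} {x : Space k} (h : ∀ m, n ≤ m → ¬ Jumps e i m x) :
    ∀ m, n ≤ m → ¬ Jumps e i m (limitMap e i x) := by
  intro m hm
  have h1 := code_limitMap e i fun j hj => h j (hm.trans hj)
  have h2 := code_limitMap e i (n := m + 1) fun j hj => h j (by omega)
  have h3 := h m hm
  rw [jumps_congr e i h2, stage_succ_of_not_jumps e i h3]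
  unfold Jumps at h3 ⊢
  rw [stage_setDigit, stage_stage, increment_congr e i (code_setDigit _ _ _)
    (code_setDigit _ _ _), increment_swap, setDigit_snd_self]
  push Not at h3 ⊢
  exact ⟨h3.1, h3.2.shift⟩

/-- Every digit is restored by some later jump. The limit is thus an involution on the exceptional
null set as well. -/
theorem limitMap_of_forall {x : Space k} (h : ∀ n, ∃ m, n ≤ m ∧ Jumps e i m x) :
    limitMap e i x = x := by
  refine Prod.ext rfl (funext fun j => ?_)
  obtain ⟨m, hm, hj⟩ := h (j + 1)
  simp only [limitMap]
  rw [if_pos ⟨m, hm, hj⟩]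

theorem limitMap_limitMap (x : Space k) : limitMap e i (limitMap e i x) = x := by
  by_cases hx : ∀ n, ∃ m, n ≤ m ∧ Jumps e i m x
  · rw [limitMap_of_forall e i hx, limitMap_of_forall e i hx]
  · push Not at hx
    obtain ⟨N, hN⟩ := hx
    have hN' := jumps_limitMap e i hN
    refine eq_of_forall_code N fun n hn => ?_
    rw [code_limitMap e i fun m hm => hN' m (hn.trans hm),
      code_stage_congr e i (code_limitMap e i fun m hm => hN m (hn.trans hm)), stage_stage]

theorem jumps_limitMap_iff {n : ℕ} {x : Space k} :
    (∀ m, n ≤ m → ¬ Jumps e i m (limitMap e i x)) ↔ ∀ m, n ≤ m → ¬ Jumps e i m x :=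
  ⟨fun h => by simpa only [limitMap_limitMap] using jumps_limitMap e i h, jumps_limitMap e i⟩

/-- The tent function of the `n`-th digit. -/
def height (n : ℕ) (x : Space k) : ℤ := tent (x.2 n)

-- Without jumps from `n` on, the shift of digit `n` survives. If a jump comes after `n`, the digit
-- is restored; if the last jump is at `n`, it is reversed, which the tent function does not see.
open Classical in
theorem height_limitMap (n : ℕ) (x : Space k) :
    height n (limitMap e i x) = height n x +
      if ∀ m, n ≤ m → ¬ Jumps e i m x then increment e i n x (limitMap e i x) else 0 := by
  by_cases h : ∀ m, n ≤ m → ¬ Jumps e i m x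
  · have h2 := (code_succ_eq_iff.1 <| code_limitMap e i (n := n + 1)
      fun j hj => h j (by omega)).2
    have h3 := h n le_rfl
    rw [if_pos h, height, h2, stage_succ_of_not_jumps e i h3, setDigit_snd_self,
      increment_congr e i rfl (code_limitMap e i h), tent_shift, height]
    unfold Jumps at h3
    push Not at h3
    exact h3.2
  · rw [if_neg h, add_zero, height, height]
    by_cases h' : ∃ m, n < m ∧ Jumps e i m x
    · simp only [limitMap]
      rw [if_pos h']
    · have hn : Jumps e i n x := by
        by_contra hn
        refine h fun m hm hj => ?_
        rcases hm.eq_or_lt with rfl | hm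
        exacts [hn hj, h' ⟨m, hm, hj⟩]
      simp only [limitMap]
      rw [if_neg h', stage_succ_of_jumps e i hn, setDigit_snd_self, tent_rev]

theorem height_limitMap_of_ne {n : ℕ} (h : (e n).1 ≠ i) (x : Space k) :
    height n (limitMap e i x) = height n x := by
  rw [height_limitMap, increment_of_ne e i h, ite_self, add_zero]

end Limit

/-! ### The two static involutions -/

section Static

variable {k : ℕ}

/-- The involution of the labels, fixing those whose first component is zero. -/
def flipLabel (l : Label k) : Label k := if l.1 = 0 then l else (l.1, !l.2)

theorem flipLabel_flipLabel (l : Label k) : flipLabel (flipLabel l) = l := by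
  unfold flipLabel
  split_ifs <;> simp_all

/-- The negative of a digit. -/
def negDig {n : ℕ} (m : Dig n) : Dig n :=
  ⟨(2 * 2 ^ n - (m : ℕ)) % (2 * 2 ^ n), Nat.mod_lt _ (two_mul_two_pow_pos n)⟩

theorem negDig_val {n : ℕ} (m : Dig n) :
    (negDig m : ℕ) = if (m : ℕ) = 0 then 0 else 2 * 2 ^ n - (m : ℕ) := by
  have := m.isLt
  unfold negDig
  split_ifs with h
  · simp [h]
  · exact Nat.mod_eq_of_lt (by omega)

theorem negDig_eq_zero {n : ℕ} {m : Dig n} : (negDig m : ℕ) = 0 ↔ (m : ℕ) = 0 := by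
  have := m.isLt
  rw [negDig_val]
  split_ifs <;> omega

theorem negDig_negDig {n : ℕ} (m : Dig n) : negDig (negDig m) = m := by
  have := m.isLt
  apply Fin.ext
  rw [negDig_val, negDig_val]
  split_ifs <;> omega

open Classical in
/-- The negative of a digit sequence, as a mixed radix number. -/
noncomputable def negSeq (y : ∀ n, Dig n) (n : ℕ) : Dig n :=
  if ∀ m < n, (y m : ℕ) = 0 then negDig (y n) else (y n).rev

theorem negSeq_zero_iff (y : ∀ n, Dig n) (n : ℕ) :
    (∀ m < n, (negSeq y m : ℕ) = 0) ↔ ∀ m < n, (y m : ℕ) = 0 := by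
  induction n with
  | zero => simp
  | succ n ih =>
    simp only [Nat.lt_succ_iff_lt_or_eq, or_imp, forall_and, forall_eq, ih]
    refine and_congr_right fun h => ?_
    rw [negSeq, if_pos h, negDig_eq_zero]

theorem negSeq_negSeq (y : ∀ n, Dig n) : negSeq (negSeq y) = y := by
  funext n
  rw [negSeq]
  simp only [negSeq_zero_iff]
  by_cases h : ∀ m < n, (y m : ℕ) = 0
  · rw [if_pos h, negSeq, if_pos h, negDig_negDig]
  · rw [if_neg h, negSeq, if_neg h, Fin.rev_rev]

theorem val_eq_zero_iff {n : ℕ} {y : ∀ n, Dig n} : val n y = 0 ↔ ∀ m < n, (y m : ℕ) = 0 := by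
  rw [val, Finset.sum_eq_zero_iff]
  simp only [Finset.mem_range, mul_eq_zero, (place_pos _).ne', or_false]

theorem val_rev (n : ℕ) (y : ∀ n, Dig n) :
    val n (fun m => (y m).rev) + val n y + 1 = place n := by
  induction n with
  | zero => simp [val, place]
  | succ n ih =>
    have := (y n).isLt
    have h : ((y n).rev : ℕ) + (y n : ℕ) + 1 = 2 * 2 ^ n := by rw [Fin.val_rev]; omega
    rw [val_succ, val_succ, place]
    linear_combination ih + place n * h

theorem val_negSeq {n : ℕ} {y : ∀ n, Dig n} (h : val n y ≠ 0) :
    val n (negSeq y) + val n y = place n := by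
  induction n with
  | zero => simp [val] at h
  | succ n ih =>
    have := (y n).isLt
    by_cases h0 : val n y = 0
    · have h0' : val n (negSeq y) = 0 := by
        rwa [val_eq_zero_iff, negSeq_zero_iff, ← val_eq_zero_iff]
      have hn : (y n : ℕ) ≠ 0 := fun h' => h (by rw [val_succ, h0, h', zero_mul, zero_add])
      rw [val_succ, val_succ, h0, h0', place, negSeq, if_pos (val_eq_zero_iff.1 h0), negDig_val,
        if_neg hn, zero_add, zero_add, ← add_mul, Nat.sub_add_cancel this.le, mul_comm]
    · have h : ((y n).rev : ℕ) + (y n : ℕ) + 1 = 2 * 2 ^ n := by rw [Fin.val_rev]; omega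
      rw [val_succ, val_succ, place, negSeq, if_neg (mt val_eq_zero_iff.2 h0)]
      linear_combination ih h0 + place n * h

/-- The involution reversing all digits. -/
def revMap (x : Space k) : Space k := (flipLabel x.1, fun n => (x.2 n).rev)

/-- The involution negating the digit sequence. -/
noncomputable def negMap (x : Space k) : Space k := (flipLabel x.1, negSeq x.2)

theorem revMap_revMap (x : Space k) : revMap (revMap x) = x := by
  simp [revMap, flipLabel_flipLabel]

theorem negMap_negMap (x : Space k) : negMap (negMap x) = x := by
  simp [negMap, flipLabel_flipLabel, negSeq_negSeq]

theorem code_revMap_congr {n : ℕ} {x z : Space k} (h : code n x = code n z) :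
    code n (revMap x) = code n (revMap z) := by
  rw [code_eq_iff] at h ⊢
  exact ⟨by simp [revMap, h.1], fun m hm => by simp [revMap, h.2 m hm]⟩

theorem code_negMap_congr {n : ℕ} {x z : Space k} (h : code n x = code n z) :
    code n (negMap x) = code n (negMap z) := by
  rw [code_eq_iff] at h ⊢
  refine ⟨by simp [negMap, h.1], fun m hm => ?_⟩
  have : (∀ j < m, (x.2 j : ℕ) = 0) ↔ ∀ j < m, (z.2 j : ℕ) = 0 :=
    forall₂_congr fun j hj => by rw [h.2 j (hj.trans hm)]
  simp only [negMap, negSeq, this, h.2 m hm]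

theorem height_revMap (n : ℕ) (x : Space k) : height n (revMap x) = height n x :=
  tent_rev _

theorem height_negMap {n : ℕ} {x : Space k} (h : val n x.2 ≠ 0) :
    height n (negMap x) = height n x := by
  simp only [height, negMap]
  rw [negSeq, if_neg (mt val_eq_zero_iff.2 h), tent_rev]

/-- If the lower digits vanish, the digit `n` is negated instead of reversed. The two results differ
by one place, and the tent function is 1-Lipschitz, apart from the digit 0, which is fixed. -/
theorem abs_height_negMap_sub_le (n : ℕ) (x : Space k) :
    |height n (negMap x) - height n x| ≤ 1 := by
  by_cases h : ∀ m < n, (x.2 m : ℕ) = 0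
  · simp only [height, negMap]
    rw [negSeq, if_pos h]
    have hv := negDig_val (x.2 n)
    have := (x.2 n).isLt
    unfold tent
    rw [abs_le]
    have hp : 0 < 2 ^ n := by positivity
    generalize x.2 n = m at *
    generalize negDig m = m' at *
    by_cases hm : (m : ℕ) = 0
    · rw [if_pos hm] at hv
      rw [hv, hm]
      simp
    · rw [if_neg hm] at hv
      have hv' : (m' : ℕ) + m = 2 * 2 ^ n := by omega
      clear hv
      zify at *
      split_ifs <;> omega
  · rw [height_negMap (mt val_eq_zero_iff.1 h)]
    simp

end Static

/-! ### The measure on the vertex space -/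

section Measure

variable {k : ℕ}

/-- The uniform measure on the `n`-th digit. -/
noncomputable def digitMeasure (n : ℕ) : Measure (Dig n) :=
  (PMF.uniformOfFintype (Dig n)).toMeasure

instance (n : ℕ) : IsProbabilityMeasure (digitMeasure n) := by
  unfold digitMeasure; infer_instance

theorem digitMeasure_singleton (n : ℕ) (m : Dig n) :
    digitMeasure n {m} = ((2 * 2 ^ n : ℕ) : ℝ≥0∞)⁻¹ := by
  rw [digitMeasure, PMF.toMeasure_apply_singleton _ _ (measurableSet_singleton _),
    PMF.uniformOfFintype_apply, Fintype.card_fin]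

/-- The uniform measure on the vertex space. -/
noncomputable def spaceMeasure (k : ℕ) : Measure (Space k) :=
  (PMF.uniformOfFintype (Label k)).toMeasure.prod (Measure.infinitePi digitMeasure)

instance : IsProbabilityMeasure (spaceMeasure k) := by
  unfold spaceMeasure; infer_instance

theorem measurable_digit (n : ℕ) : Measurable fun x : Space k => x.2 n :=
  (measurable_pi_apply n).comp measurable_snd

theorem measurable_code (n : ℕ) : Measurable (code n : Space k → Label k × ℕ) := by
  refine measurable_fst.prodMk ?_
  refine Finset.measurable_fun_sum _ fun m _ => ?_
  exact (measurable_of_countable fun j : Dig m => (j : ℕ) * place m).comp (measurable_digit m)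

theorem measurableSet_cell (n : ℕ) (q : Label k × ℕ) :
    MeasurableSet (code n ⁻¹' {q} : Set (Space k)) :=
  measurable_code n (measurableSet_singleton q)

theorem spaceMeasure_cell (n : ℕ) (x : Space k) :
    spaceMeasure k (code n ⁻¹' {code n x}) =
      (Fintype.card (Label k) : ℝ≥0∞)⁻¹ *
        ∏ m ∈ Finset.range n, ((2 * 2 ^ m : ℕ) : ℝ≥0∞)⁻¹ := by
  have h : (code n ⁻¹' {code n x} : Set (Space k)) =
      {x.1} ×ˢ Set.pi (Finset.range n : Set ℕ) fun m => {x.2 m} := by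
    ext z
    simp only [mem_preimage, mem_singleton_iff, code_eq_iff, mem_prod, Set.mem_pi,
      Finset.mem_coe, Finset.mem_range]
  rw [h, spaceMeasure, Measure.prod_prod,
    PMF.toMeasure_apply_singleton _ _ (measurableSet_singleton _), PMF.uniformOfFintype_apply,
    Measure.infinitePi_pi _ fun _ _ => measurableSet_singleton _]
  simp only [digitMeasure_singleton]

theorem spaceMeasure_cell_eq (n : ℕ) (x z : Space k) :
    spaceMeasure k (code n ⁻¹' {code n x}) = spaceMeasure k (code n ⁻¹' {code n z}) := by
  rw [spaceMeasure_cell, spaceMeasure_cell]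

theorem spaceMeasure_cell_ne_zero (n : ℕ) (x : Space k) :
    spaceMeasure k (code n ⁻¹' {code n x}) ≠ 0 := by
  rw [spaceMeasure_cell]
  refine mul_ne_zero (ENNReal.inv_ne_zero.2 (ENNReal.natCast_ne_top _)) ?_
  exact Finset.prod_ne_zero_iff.2 fun m _ => ENNReal.inv_ne_zero.2 (ENNReal.natCast_ne_top _)

/-- The cylinder sets of level at least `N`. -/
def cells (k N : ℕ) : Set (Set (Space k)) := {A | ∃ n x, N ≤ n ∧ A = code n ⁻¹' {code n x}}

theorem isPiSystem_cells (N : ℕ) : IsPiSystem (cells k N) := by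
  have key : ∀ {n m : ℕ} {x z w : Space k}, n ≤ m → code n w = code n x → code m w = code m z →
      code n ⁻¹' {code n x} ∩ code m ⁻¹' {code m z} = code m ⁻¹' {code m z} := by
    intro n m x z w hnm hx hz
    refine inter_eq_right.2 fun y hy => ?_
    simp only [mem_preimage, mem_singleton_iff] at hy ⊢
    rw [← hx]
    exact code_mono hnm (hy.trans hz.symm)
  rintro _ ⟨n, x, hn, rfl⟩ _ ⟨m, z, hm, rfl⟩ ⟨w, hw1, hw2⟩
  rcases le_total n m with h | h
  · exact ⟨m, z, hm, key h hw1 hw2⟩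
  · exact ⟨n, x, hn, by rw [inter_comm]; exact key h hw2 hw1⟩

theorem generateFrom_cells (N : ℕ) :
    (inferInstance : MeasurableSpace (Space k)) = MeasurableSpace.generateFrom (cells k N) := by
  classical
  refine le_antisymm ?_ (MeasurableSpace.generateFrom_le ?_)
  · have hcode : ∀ n, N ≤ n →
        @Measurable _ _ (MeasurableSpace.generateFrom (cells k N)) _ (code n : Space k → _) := by
      intro n hn
      refine @measurable_to_countable' _ _ _ _ (MeasurableSpace.generateFrom (cells k N)) _
        fun q => ?_
      by_cases hq : ∃ x : Space k, code n x = q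
      · obtain ⟨x, rfl⟩ := hq
        exact MeasurableSpace.measurableSet_generateFrom ⟨n, x, hn, rfl⟩
      · have : (code n ⁻¹' {q} : Set (Space k)) = ∅ := by
          ext x; simpa using fun h => hq ⟨x, h⟩
        rw [this]
        exact @MeasurableSet.empty _ (MeasurableSpace.generateFrom (cells k N))
    have hfun : ∀ {β : Type} [MeasurableSpace β] (g : Space k → β) (n : ℕ), N ≤ n →
        (∀ x z, code n x = code n z → g x = g z) →
        @Measurable _ _ (MeasurableSpace.generateFrom (cells k N)) _ g := by
      intro β _ g n hn hg
      have : g = (fun q => if h : ∃ x : Space k, code n x = q then g h.choose else g default) ∘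
          code n := by
        funext x
        have h : ∃ z : Space k, code n z = code n x := ⟨x, rfl⟩
        simp only [Function.comp_apply]
        rw [dif_pos h]
        exact hg _ _ h.choose_spec.symm
      rw [this]
      exact (measurable_of_countable _).comp (hcode n hn)
    have hfst := hfun (fun x => x.1) N le_rfl fun x z h => (code_eq_iff.1 h).1
    have hsnd : @Measurable _ _ (MeasurableSpace.generateFrom (cells k N)) _
        (fun x : Space k => x.2) := by
      refine @measurable_pi_lambda _ _ _ (MeasurableSpace.generateFrom (cells k N)) _ _
        fun m => ?_
      exact hfun _ (N + (m + 1)) (by omega) fun x z h => (code_eq_iff.1 h).2 m (by omega)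
    have hid : @Measurable _ _ (MeasurableSpace.generateFrom (cells k N)) _
        (fun x : Space k => (x.1, x.2)) := hfst.prodMk hsnd
    exact fun A hA => hid hA
  · rintro _ ⟨n, x, -, rfl⟩
    exact measurableSet_cell n _

/-- Cells of high level still form a generating π-system. Discarding low levels matters because
`stage e i n` respects cells only from level `n` on. -/
theorem measure_eq_of_cells {μ : Measure (Space k)} [IsProbabilityMeasure μ] (N : ℕ)
    (h : ∀ n x, N ≤ n →
      μ (code n ⁻¹' {code n x}) = spaceMeasure k (code n ⁻¹' {code n x})) :
    μ = spaceMeasure k := by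
  refine ext_of_generate_finite _ (generateFrom_cells N) (isPiSystem_cells N) ?_ (by simp)
  rintro _ ⟨n, x, hn, rfl⟩
  exact h n x hn

theorem measurable_of_cells {α : Type*} [MeasurableSpace α] {φ : α → Space k} (N : ℕ)
    (h : ∀ n x, N ≤ n → MeasurableSet (φ ⁻¹' (code n ⁻¹' {code n x}))) : Measurable φ := by
  have := @measurable_generateFrom α (Space k) _ (cells k N) φ (by
    rintro _ ⟨n, x, hn, rfl⟩
    exact h n x hn)
  rwa [← generateFrom_cells N] at this

/-- An involution compatible with the cylinder sets of high level preserves the measure. -/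
theorem measurePreserving_of_code {φ : Space k → Space k} (N : ℕ)
    (hφ : ∀ n x z, N ≤ n → code n x = code n z → code n (φ x) = code n (φ z))
    (hφφ : ∀ x, φ (φ x) = x) : MeasurePreserving φ (spaceMeasure k) (spaceMeasure k) := by
  have hpre : ∀ n x, N ≤ n → φ ⁻¹' (code n ⁻¹' {code n x}) = code n ⁻¹' {code n (φ x)} := by
    intro n x hn
    ext z
    simp only [mem_preimage, mem_singleton_iff]
    constructor
    · intro h
      simpa only [hφφ] using hφ n _ _ hn h
    · intro h
      simpa only [hφφ] using hφ n _ _ hn h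
  have hm : Measurable φ := measurable_of_cells N fun n x hn => by
    rw [hpre n x hn]
    exact measurableSet_cell n _
  have := Measure.isProbabilityMeasure_map (μ := spaceMeasure k) hm.aemeasurable
  refine ⟨hm, measure_eq_of_cells N fun n x hn => ?_⟩
  rw [Measure.map_apply hm (measurableSet_cell n _), hpre n x hn]
  -- The involution permutes the cells of each level, which all have the same measure.
  exact spaceMeasure_cell_eq _ _ _

theorem measurePreserving_revMap :
    MeasurePreserving (revMap : Space k → _) (spaceMeasure k) (spaceMeasure k) :=
  measurePreserving_of_code 0 (fun _ _ _ _ => code_revMap_congr) revMap_revMap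

theorem measurePreserving_negMap :
    MeasurePreserving (negMap : Space k → _) (spaceMeasure k) (spaceMeasure k) :=
  measurePreserving_of_code 0 (fun _ _ _ _ => code_negMap_congr) negMap_negMap

theorem measurableSet_of_code (n : ℕ) {A : Set (Space k)}
    (h : ∀ x z, code n x = code n z → (x ∈ A ↔ z ∈ A)) : MeasurableSet A := by
  have : A = code n ⁻¹' (code n '' A) := by
    refine (subset_preimage_image _ _).antisymm ?_
    rintro x ⟨z, hz, hzx⟩
    exact (h _ _ hzx).1 hz
  rw [this]
  exact measurable_code n (to_countable _).measurableSet

theorem spaceMeasure_digit_mem (n : ℕ) (s : Set (Dig n)) :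
    spaceMeasure k {x | x.2 n ∈ s} = digitMeasure n s := by
  have h1 : MeasurePreserving (Prod.snd : Space k → _) (spaceMeasure k)
      (Measure.infinitePi digitMeasure) := measurePreserving_snd
  have h2 := (measurePreserving_eval_infinitePi digitMeasure n).comp h1
  exact h2.measure_preimage (to_countable s).measurableSet.nullMeasurableSet

end Measure

/-! ### Almost sure convergence and measure preservation of the limit involutions. -/

section LimitMeasure

variable {k d : ℕ} (e : ℕ → Fin d × ℕ × (Label k × ℕ)) (i : Fin d)

theorem measurableSet_jumps (n : ℕ) : MeasurableSet {x | Jumps e i n x} :=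
  measurableSet_of_code (n + 1) fun _ _ h => jumps_congr e i h

theorem spaceMeasure_jumps_le {n : ℕ} (hn : n ≠ 0) :
    spaceMeasure k {x | Jumps e i n x} ≤ 2 * (2 : ℝ≥0∞)⁻¹ ^ n := by
  have hp : 0 < 2 ^ n := by positivity
  let s : Finset (Dig n) := {⟨0, by omega⟩, ⟨2 ^ n - 1, by omega⟩, ⟨2 ^ n, by omega⟩,
    ⟨2 * 2 ^ n - 1, by omega⟩}
  have hsub : {x : Space k | Jumps e i n x} ⊆ {x | x.2 n ∈ (s : Set (Dig n))} := by
    intro x hx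
    have h := not_advances (abs_increment_le e i n x (stage e i n x)) (hx.resolve_left hn)
    simp only [s, Finset.coe_insert, Finset.coe_singleton, mem_ofPred_eq, mem_insert_iff,
      mem_singleton_iff, Fin.ext_iff]
    exact h
  have hs : s.card ≤ 4 := Finset.card_le_four
  calc spaceMeasure k {x | Jumps e i n x}
      ≤ digitMeasure n (s : Set (Dig n)) := by
        rw [← spaceMeasure_digit_mem (k := k)]; exact measure_mono hsub
    _ = ∑ m ∈ s, digitMeasure n {m} := by rw [sum_measure_singleton]
    _ = s.card * ((2 * 2 ^ n : ℕ) : ℝ≥0∞)⁻¹ := by simp [digitMeasure_singleton]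
    _ ≤ 4 * ((2 * 2 ^ n : ℕ) : ℝ≥0∞)⁻¹ := by gcongr; exact_mod_cast hs
    _ = 2 * (2 : ℝ≥0∞)⁻¹ ^ n := by
      push_cast
      rw [ENNReal.mul_inv (.inl two_ne_zero) (.inl ENNReal.ofNat_ne_top), ← mul_assoc,
        ← ENNReal.inv_pow]
      congr 1
      rw [show (4 : ℝ≥0∞) = 2 * 2 by norm_num, mul_assoc,
        ENNReal.mul_inv_cancel two_ne_zero ENNReal.ofNat_ne_top, mul_one]

theorem tsum_spaceMeasure_jumps_ne_top :
    ∑' n, spaceMeasure k {x | Jumps e i n x} ≠ ∞ := by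
  have h : ∀ n, spaceMeasure k {x | Jumps e i n x} ≤ 2 * (2 : ℝ≥0∞)⁻¹ ^ n := by
    intro n
    rcases eq_or_ne n 0 with rfl | hn
    -- Every point jumps at stage 0; the factor 2 in the bound covers this.
    · exact prob_le_one.trans (by norm_num)
    · exact spaceMeasure_jumps_le e i hn
  refine ne_top_of_le_ne_top ?_ (ENNReal.tsum_le_tsum h)
  rw [ENNReal.tsum_mul_left, ENNReal.tsum_geometric, ENNReal.one_sub_inv_two, inv_inv]
  norm_num

/-- The set where there are no jumps from stage `n` on. -/
def calm (n : ℕ) : Set (Space k) := {x | ∀ m, n ≤ m → ¬ Jumps e i m x}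

theorem calm_mono : Monotone (calm e i) := fun _ _ h _ hx m hm => hx m (h.trans hm)

theorem measurableSet_calm (n : ℕ) : MeasurableSet (calm e i n) := by
  have : calm e i n = ⋂ m, ⋂ (_ : n ≤ m), {x | Jumps e i m x}ᶜ := by
    ext x; simp [calm]
  rw [this]
  exact .iInter fun m => .iInter fun _ => (measurableSet_jumps e i m).compl

/-- Borel–Cantelli for the jumps. -/
theorem ae_mem_iUnion_calm : ∀ᵐ x ∂spaceMeasure k, x ∈ ⋃ n, calm e i n := by
  filter_upwards [ae_eventually_notMem (tsum_spaceMeasure_jumps_ne_top e i)] with x hx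
  obtain ⟨n, hn⟩ := Filter.eventually_atTop.1 hx
  exact mem_iUnion.2 ⟨n, hn⟩

theorem tendsto_spaceMeasure_calm_compl :
    Filter.Tendsto (fun n => spaceMeasure k (calm e i n)ᶜ) Filter.atTop (nhds 0) := by
  have h : spaceMeasure k (⋂ n, (calm e i n)ᶜ) = 0 := by
    rw [← compl_iUnion]
    exact ae_mem_iUnion_calm e i
  rw [← h]
  exact tendsto_measure_iInter_atTop
    (fun n => (measurableSet_calm e i n).compl.nullMeasurableSet)
    (fun _ _ h => compl_subset_compl.2 (calm_mono e i h)) ⟨0, measure_ne_top _ _⟩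

theorem measurePreserving_stage (n : ℕ) :
    MeasurePreserving (stage e i n) (spaceMeasure k) (spaceMeasure k) :=
  measurePreserving_of_code n (fun _ _ _ h => code_stage_congr_of_le e i h) (stage_stage e i n)

theorem measurable_limitMap : Measurable (limitMap e i : Space k → Space k) := by
  classical
  refine measurable_fst.prodMk (measurable_pi_lambda _ fun j => ?_)
  refine Measurable.ite ?_ (measurable_digit j)
    ((measurable_digit j).comp (measurePreserving_stage e i _).measurable)
  have : {x : Space k | ∃ m, j < m ∧ Jumps e i m x} =
      ⋃ m, ⋃ (_ : j < m), {x | Jumps e i m x} := by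
    ext x; simp
  rw [this]
  exact .iUnion fun m => .iUnion fun _ => measurableSet_jumps e i m

/-- On `calm e i m` the limit lands in a cell of level at most `m` exactly when stage `m` does.
Stage `m` preserves the measure and the complement of the calm set shrinks to measure zero, so both
inequalities hold in the limit. -/
theorem measurePreserving_limitMap :
    MeasurePreserving (limitMap e i) (spaceMeasure k) (spaceMeasure k) := by
  have hm := measurable_limitMap e i (k := k)
  have := Measure.isProbabilityMeasure_map (μ := spaceMeasure k) hm.aemeasurable
  refine ⟨hm, measure_eq_of_cells 0 fun n x _ => ?_⟩
  set A : Set (Space k) := code n ⁻¹' {code n x} with hA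
  have hAm : MeasurableSet A := measurableSet_cell n _
  have hiff : ∀ m, n ≤ m → ∀ z ∈ calm e i m, (limitMap e i z ∈ A ↔ stage e i m z ∈ A) := by
    intro m hm z hz
    simp only [hA, mem_preimage, mem_singleton_iff]
    rw [code_mono hm (code_limitMap e i hz)]
  have ht : Filter.Tendsto (fun m => spaceMeasure k A + spaceMeasure k (calm e i m)ᶜ)
      Filter.atTop (nhds (spaceMeasure k A)) := by
    simpa using (tendsto_spaceMeasure_calm_compl e i).const_add (spaceMeasure k A)
  have ht' : Filter.Tendsto (fun m => (spaceMeasure k).map (limitMap e i) A +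
      spaceMeasure k (calm e i m)ᶜ) Filter.atTop
      (nhds ((spaceMeasure k).map (limitMap e i) A)) := by
    simpa using (tendsto_spaceMeasure_calm_compl e i).const_add
      ((spaceMeasure k).map (limitMap e i) A)
  refine le_antisymm (ge_of_tendsto ht ?_) (ge_of_tendsto ht' ?_) <;>
    refine Filter.eventually_atTop.2 ⟨n, fun m hm' => ?_⟩
  · rw [Measure.map_apply hm hAm, ← (measurePreserving_stage e i m).measure_preimage
      hAm.nullMeasurableSet]
    refine (measure_mono fun z hz => ?_).trans (measure_union_le _ _)
    by_cases hc : z ∈ calm e i m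
    · exact .inl ((hiff m hm' z hc).1 hz)
    · exact .inr hc
  · rw [Measure.map_apply hm hAm, ← (measurePreserving_stage e i m).measure_preimage
      hAm.nullMeasurableSet]
    refine (measure_mono fun z hz => ?_).trans (measure_union_le _ _)
    by_cases hc : z ∈ calm e i m
    · exact .inl ((hiff m hm' z hc).2 hz)
    · exact .inr hc

end LimitMeasure

/-! ### Sequences that begin with zeros. -/

section Zero

variable {k : ℕ}

theorem tendsto_spaceMeasure_val_eq_zero :
    Filter.Tendsto (fun n => spaceMeasure k {x | val n x.2 = 0}) Filter.atTop (nhds 0) := by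
  have hle : ∀ n, spaceMeasure k {x | val (n + 1) x.2 = 0} ≤ (2 : ℝ≥0∞)⁻¹ ^ n := by
    intro n
    calc spaceMeasure k {x | val (n + 1) x.2 = 0}
        ≤ digitMeasure n {0} := by
          rw [← spaceMeasure_digit_mem (k := k)]
          refine measure_mono fun x hx => ?_
          exact Fin.ext (val_eq_zero_iff.1 hx n n.lt_succ_self)
      _ = ((2 * 2 ^ n : ℕ) : ℝ≥0∞)⁻¹ := digitMeasure_singleton _ _
      _ ≤ (2 : ℝ≥0∞)⁻¹ ^ n := by
          rw [← ENNReal.inv_pow, ENNReal.inv_le_inv]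
          push_cast
          exact le_mul_of_one_le_left' (by norm_num)
  refine (Filter.tendsto_add_atTop_iff_nat 1).1 ?_
  exact tendsto_of_tendsto_of_tendsto_of_le_of_le tendsto_const_nhds
    (ENNReal.tendsto_pow_atTop_nhds_zero_of_lt_one (by simp)) (fun _ => zero_le) hle

theorem measurableSet_val_eq_zero (n : ℕ) : MeasurableSet {x : Space k | val n x.2 = 0} :=
  measurableSet_of_code n fun x z h => by
    simp only [mem_ofPred_eq, val_eq_iff.2 (code_eq_iff.1 h).2]

theorem ae_val_ne_zero : ∀ᵐ x ∂spaceMeasure k, ∃ n, val n x.2 ≠ 0 := by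
  have h : spaceMeasure k {x | ¬ ∃ n, val n x.2 ≠ 0} ≤ 0 := by
    refine ge_of_tendsto' (tendsto_spaceMeasure_val_eq_zero (k := k)) fun n => measure_mono ?_
    intro x hx
    simp only [mem_ofPred_eq, not_exists, not_not] at hx
    exact hx n
  exact le_antisymm h zero_le

theorem val_ne_zero_mono {y : ∀ n, Dig n} {m n : ℕ} (h : m ≤ n) (hm : val m y ≠ 0) :
    val n y ≠ 0 := fun h' =>
  hm (val_eq_zero_iff.2 fun j hj => val_eq_zero_iff.1 h' j (hj.trans_le h))

end Zero

/-! ### Integrable circulations -/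

section Integral

variable {k d : ℕ}

theorem ae_eq_zero_of_setIntegral_cell {F : Space k → ℝ} (hF : Integrable F (spaceMeasure k))
    (h : ∀ n x, ∫ z in code n ⁻¹' {code n x}, F z ∂spaceMeasure k = 0) :
    F =ᵐ[spaceMeasure k] 0 := by
  -- Complements in the π-λ argument need the total integral, which is the sum over the finitely
  -- many cells of level 0, one for each label.
  have huniv : ∫ z, F z ∂spaceMeasure k = 0 := by
    have hU : (⋃ l : Label k, code 0 ⁻¹' {(l, 0)} : Set (Space k)) = univ := by
      refine eq_univ_of_forall fun x => mem_iUnion.2 ⟨x.1, ?_⟩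
      simp [code, val]
    rw [← setIntegral_univ, ← hU, integral_iUnion (fun l => measurableSet_cell 0 _) ?_
      hF.integrableOn, tsum_fintype]
    · refine Finset.sum_eq_zero fun l _ => ?_
      exact h 0 (l, fun _ => 0)
    · intro l l' hl
      refine Set.disjoint_left.2 fun x hx hx' => hl ?_
      exact (Prod.ext_iff.1 (hx.symm.trans hx')).1
  have hall : ∀ A : Set (Space k), MeasurableSet A → ∫ z in A, F z ∂spaceMeasure k = 0 := by
    intro A hA
    induction A, hA using MeasurableSpace.induction_on_inter (generateFrom_cells 0)
      (isPiSystem_cells 0) with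
    | empty => simp
    | basic A hA =>
      obtain ⟨n, x, -, rfl⟩ := hA
      exact h n x
    | compl A hA ih =>
      have := integral_add_compl hA hF
      rw [ih, huniv, zero_add] at this
      exact this
    | iUnion f hd hm ih =>
      rw [integral_iUnion hm hd hF.integrableOn]
      simp [ih]
  exact hF.ae_eq_zero_of_forall_setIntegral_eq_zero fun A hA _ => hall A hA

/-- The involutions that define the graph. -/
noncomputable def colorMap (e : ℕ → Fin d × ℕ × (Label k × ℕ)) (i : Fin d) :
    Space k → Space k :=
  if (i : ℕ) = 0 then revMap else if (i : ℕ) = 1 then negMap else limitMap e i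

variable (e : ℕ → Fin d × ℕ × (Label k × ℕ))

theorem colorMap_of_eq_zero {i : Fin d} (h : (i : ℕ) = 0) : colorMap e i = revMap := if_pos h

theorem colorMap_of_eq_one {i : Fin d} (h : (i : ℕ) = 1) : colorMap e i = negMap := by
  rw [colorMap, if_neg (by omega), if_pos h]

theorem colorMap_of_two_le {i : Fin d} (h : 2 ≤ (i : ℕ)) : colorMap e i = limitMap e i := by
  rw [colorMap, if_neg (by omega), if_neg (by omega)]

theorem colorMap_colorMap (i : Fin d) (x : Space k) : colorMap e i (colorMap e i x) = x := by
  unfold colorMap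
  split_ifs
  exacts [revMap_revMap x, negMap_negMap x, limitMap_limitMap e i x]

theorem measurePreserving_colorMap (i : Fin d) :
    MeasurePreserving (colorMap e i) (spaceMeasure k) (spaceMeasure k) := by
  unfold colorMap
  split_ifs
  exacts [measurePreserving_revMap, measurePreserving_negMap, measurePreserving_limitMap e i]

theorem height_colorMap_of_ne {n : ℕ} {i : Fin d} (hi : (i : ℕ) ≠ 1) (hn : (e n).1 ≠ i)
    (x : Space k) : height n (colorMap e i x) = height n x := by
  rcases eq_or_ne (i : ℕ) 0 with h0 | h0
  · rw [colorMap_of_eq_zero e h0, height_revMap]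
  · rw [colorMap_of_two_le e (by omega), height_limitMap_of_ne e i hn]

theorem integral_comp_colorMap (i : Fin d) (F : Space k → ℝ) :
    ∫ x, F (colorMap e i x) ∂spaceMeasure k = ∫ x, F x ∂spaceMeasure k :=
  (measurePreserving_colorMap e i).integral_comp
    (MeasurableEquiv.ofInvolutive _ (colorMap_colorMap e i)
      (measurePreserving_colorMap e i).measurable).measurableEmbedding F

theorem measurable_height (n : ℕ) : Measurable fun x : Space k => (height n x : ℝ) :=
  (measurable_of_countable fun m : Dig n => (tent m : ℝ)).comp (measurable_digit n)

theorem abs_height_le (n : ℕ) (x : Space k) : |(height n x : ℝ)| ≤ 2 * 2 ^ n := by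
  have h := (x.2 n).isLt
  have : |height n x| ≤ 2 * 2 ^ n := by
    unfold height tent
    rw [abs_le]
    have hp : 0 < 2 ^ n := by positivity
    generalize x.2 n = m at *
    zify at *
    split_ifs <;> omega
  exact_mod_cast this

variable {F : Fin d → Space k → ℝ}

theorem integrable_height_mul {G : Space k → ℝ} (hG : Integrable G (spaceMeasure k)) (n : ℕ) :
    Integrable (fun x => (height n x : ℝ) * G x) (spaceMeasure k) :=
  hG.bdd_mul (measurable_height n).aestronglyMeasurable
    (Filter.Eventually.of_forall fun x => abs_height_le n x)

theorem integrable_height_comp_mul {G : Space k → ℝ} (hG : Integrable G (spaceMeasure k))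
    (n : ℕ) (i : Fin d) :
    Integrable (fun x => (height n (colorMap e i x) : ℝ) * G x) (spaceMeasure k) :=
  hG.bdd_mul
    ((measurable_height n).comp (measurePreserving_colorMap e i).measurable).aestronglyMeasurable
    (Filter.Eventually.of_forall fun _ => abs_height_le n _)

/-- The total work of an integrable circulation against a tent function vanishes. -/
theorem sum_integral_height_sub_mul (hF : ∀ i, Integrable (F i) (spaceMeasure k))
    (hanti : ∀ i x, F i (colorMap e i x) = -F i x) (hsum : ∀ x, ∑ i, F i x = 0) (n : ℕ) :
    ∑ i, ∫ x, ((height n (colorMap e i x) : ℝ) - height n x) * F i x ∂spaceMeasure k = 0 := by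
  have h1 : ∀ i, ∫ x, ((height n (colorMap e i x) : ℝ) - height n x) * F i x ∂spaceMeasure k =
      -2 * ∫ x, (height n x : ℝ) * F i x ∂spaceMeasure k := by
    intro i
    have h2 := integral_comp_colorMap e i fun x => (height n x : ℝ) * F i x
    simp only [hanti, mul_neg, integral_neg] at h2
    simp only [sub_mul]
    rw [integral_sub (integrable_height_comp_mul e (hF i) n i) (integrable_height_mul (hF i) n)]
    linarith
  simp only [h1]
  rw [← Finset.mul_sum, ← integral_finsetSum _ fun i _ => integrable_height_mul (hF i) n]
  simp [← Finset.mul_sum, hsum]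

/-- The calm set is invariant, so the height difference is the indicator of the set on the right at
`x` minus that at its partner. By antisymmetry and invariance of the measure, both terms contribute
the same integral. -/
theorem integral_height_limitMap_sub_mul {i : Fin d} (hi : 2 ≤ (i : ℕ))
    (hF : Integrable (F i) (spaceMeasure k))
    (hanti : ∀ x, F i (colorMap e i x) = -F i x) {n m : ℕ} {q : Label k × ℕ} (hmn : m ≤ n)
    (hn : e n = (i, m, q)) :
    ∫ x, ((height n (colorMap e i x) : ℝ) - height n x) * F i x ∂spaceMeasure k =
      2 * ∫ x in calm e i n ∩ code m ⁻¹' {q}, F i x ∂spaceMeasure k := by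
  classical
  set A : Set (Space k) := calm e i n ∩ code m ⁻¹' {q} with hA
  have hAm : MeasurableSet A := (measurableSet_calm e i n).inter (measurableSet_cell m q)
  have hcalm : ∀ x, colorMap e i x ∈ calm e i n ↔ x ∈ calm e i n := by
    intro x
    rw [colorMap_of_two_le e hi]
    exact jumps_limitMap_iff e i
  have htarget : ∀ x, x ∈ target e n ↔ x ∈ (code m ⁻¹' {q} : Set (Space k)) := by
    intro x
    simp [target, hn, hmn]
  have hpt : ∀ x, ((height n (colorMap e i x) : ℝ) - height n x) * F i x =
      A.indicator (F i) x + A.indicator (F i) (colorMap e i x) := by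
    intro x
    have hh := height_limitMap e i n x
    rw [← colorMap_of_two_le e hi] at hh
    rw [hh]
    have hx : (∀ m, n ≤ m → ¬ Jumps e i m x) ↔ x ∈ calm e i n := Iff.rfl
    simp only [hx, increment, hn, if_true, indicator_apply, htarget, hA, mem_inter_iff, hcalm,
      hanti, Pi.one_apply]
    by_cases h1 : x ∈ calm e i n <;>
      by_cases h2 : x ∈ (code m ⁻¹' {q} : Set (Space k)) <;>
      by_cases h3 : colorMap e i x ∈ (code m ⁻¹' {q} : Set (Space k)) <;>
      simp [h1, h2, h3]
  simp only [hpt]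
  have hint := hF.indicator hAm
  have hint' : Integrable (fun x => A.indicator (F i) (colorMap e i x)) (spaceMeasure k) :=
    (measurePreserving_colorMap e i).integrable_comp_of_integrable hint
  rw [integral_add hint hint', integral_comp_colorMap e i (A.indicator (F i)), integral_indicator hAm]
  ring

theorem abs_integral_height_negMap_sub_mul_le {i : Fin d} (hi : (i : ℕ) = 1)
    (hF : Integrable (F i) (spaceMeasure k)) (n : ℕ) :
    |∫ x, ((height n (colorMap e i x) : ℝ) - height n x) * F i x ∂spaceMeasure k| ≤
      ∫ x in {x | val n x.2 = 0}, |F i x| ∂spaceMeasure k := by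
  rw [← integral_indicator (measurableSet_val_eq_zero n)]
  refine abs_integral_le_integral_abs.trans (integral_mono ?_ ?_ fun x => ?_)
  · refine Integrable.abs ?_
    simp only [sub_mul]
    exact (integrable_height_comp_mul e hF n i).sub (integrable_height_mul hF n)
  · exact hF.abs.indicator (measurableSet_val_eq_zero n)
  · simp only [colorMap_of_eq_one e hi]
    by_cases hx : val n x.2 = 0
    · rw [indicator_of_mem (by exact hx), abs_mul]
      have : |((height n (negMap x) : ℝ) - height n x)| ≤ 1 := by
        exact_mod_cast abs_height_negMap_sub_le n x
      nlinarith [abs_nonneg (F i x)]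
    · rw [indicator_of_notMem (by exact hx), height_negMap hx]
      simp

theorem tendsto_setIntegral_val_eq_zero {G : Space k → ℝ} (hG : Integrable G (spaceMeasure k)) :
    Filter.Tendsto (fun n => ∫ x in {x | val n x.2 = 0}, G x ∂spaceMeasure k) Filter.atTop
      (nhds 0) := by
  have h : ∫ x in ⋂ n, {x : Space k | val n x.2 = 0}, G x ∂spaceMeasure k = 0 := by
    refine setIntegral_measure_zero _ ?_
    have := ae_val_ne_zero (k := k)
    rw [ae_iff] at this
    rw [← this]
    congr 1
    ext x
    simp
  rw [← h]
  refine tendsto_setIntegral_of_antitone measurableSet_val_eq_zero ?_ ⟨0, hG.integrableOn⟩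
  intro m n hmn x hx
  by_contra hx'
  exact val_ne_zero_mono hmn hx' hx

theorem tendsto_setIntegral_calm (i : Fin d) {G : Space k → ℝ}
    (hG : Integrable G (spaceMeasure k)) {A : Set (Space k)} (hA : MeasurableSet A) :
    Filter.Tendsto (fun n => ∫ x in calm e i n ∩ A, G x ∂spaceMeasure k) Filter.atTop
      (nhds (∫ x in A, G x ∂spaceMeasure k)) := by
  have h : ∫ x in ⋃ n, calm e i n ∩ A, G x ∂spaceMeasure k = ∫ x in A, G x ∂spaceMeasure k := by
    refine setIntegral_congr_set ?_
    filter_upwards [ae_mem_iUnion_calm e i] with x hx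
    rw [← iUnion_inter]
    exact propext (and_iff_right hx)
  rw [← h]
  exact tendsto_setIntegral_of_monotone (fun n => (measurableSet_calm e i n).inter hA)
    (fun _ _ hmn => inter_subset_inter_left _ (calm_mono e i hmn)) hG.integrableOn

variable {e}

/-- An integrable circulation vanishes on the edges of color at least two. -/
theorem ae_eq_zero_of_two_le (he : ∀ q N, ∃ n, N ≤ n ∧ e n = q)
    (hF : ∀ i, Integrable (F i) (spaceMeasure k))
    (hanti : ∀ i x, F i (colorMap e i x) = -F i x) (hsum : ∀ x, ∑ i, F i x = 0) {i : Fin d}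
    (hi : 2 ≤ (i : ℕ)) : F i =ᵐ[spaceMeasure k] 0 := by
  refine ae_eq_zero_of_setIntegral_cell (hF i) fun m x => ?_
  set q := code m x
  set j : Fin d := ⟨1, by omega⟩ with hj
  have hij : i ≠ j := by
    intro h
    rw [h] at hi
    simp [hj] at hi
  -- At the times when this color and cell are scheduled, only the colors `i` and 1 do any work.
  -- There are infinitely many such times, so a limit can be taken along them.
  have hfreq : ∃ᶠ n in Filter.atTop,
      |2 * ∫ x in calm e i n ∩ code m ⁻¹' {q}, F i x ∂spaceMeasure k| -
        ∫ x in {x | val n x.2 = 0}, |F j x| ∂spaceMeasure k ≤ 0 := by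
    refine Filter.frequently_atTop.2 fun N => ?_
    -- The bound `m ≤ n` makes the cell visible at stage `n`.
    obtain ⟨n, hn, hen⟩ := he (i, m, q) (max N m)
    refine ⟨n, (le_max_left _ _).trans hn, ?_⟩
    have hs := sum_integral_height_sub_mul e hF hanti hsum n
    rw [Fintype.sum_eq_add i j hij] at hs
    · rw [integral_height_limitMap_sub_mul e hi (hF i) (hanti i) ((le_max_right _ _).trans hn)
        hen] at hs
      have := abs_integral_height_negMap_sub_mul_le e (i := j) rfl (hF j) n
      rw [eq_neg_of_add_eq_zero_left hs, abs_neg]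
      linarith
    · rintro l ⟨hli, hlj⟩
      have hl : (l : ℕ) ≠ 1 := fun h => hlj (Fin.ext h)
      have hl' : (e n).1 ≠ l := by rw [hen]; exact hli.symm
      simp only [height_colorMap_of_ne e hl hl', sub_self, zero_mul, integral_zero]
  have hlim := ((((tendsto_setIntegral_calm e i (hF i) (measurableSet_cell m q)).const_mul
    2).abs).sub (tendsto_setIntegral_val_eq_zero (hF j).abs))
  have := le_of_tendsto_of_frequently hlim hfreq
  rw [sub_zero] at this
  have := abs_nonpos_iff.1 this
  linarith

/-- An integrable function reversed by both static involutions only depends on the label. -/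
theorem ae_eq_label_of_neg {G : Space k → ℝ} (hG : Integrable G (spaceMeasure k))
    (hrev : ∀ᵐ x ∂spaceMeasure k, G (revMap x) = -G x)
    (hneg : ∀ᵐ x ∂spaceMeasure k, G (negMap x) = -G x) :
    ∃ γ : Label k → ℝ, (∀ l, γ (flipLabel l) = -γ l) ∧ G =ᵐ[spaceMeasure k] fun x => γ x.1 := by
  have hcomp : ∀ (φ : Space k → Space k), MeasurePreserving φ (spaceMeasure k) (spaceMeasure k) →
      (∀ x, φ (φ x) = x) → (∀ n x z, code n x = code n z → code n (φ x) = code n (φ z)) →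
      (∀ᵐ x ∂spaceMeasure k, G (φ x) = -G x) → ∀ n x,
      ∫ z in code n ⁻¹' {code n (φ x)}, G z ∂spaceMeasure k =
        -∫ z in code n ⁻¹' {code n x}, G z ∂spaceMeasure k := by
    intro φ hφ hφφ hcode hGφ n x
    have hpre : φ ⁻¹' (code n ⁻¹' {code n (φ x)}) = code n ⁻¹' {code n x} := by
      ext z
      simp only [mem_preimage, mem_singleton_iff]
      exact ⟨fun h => by simpa only [hφφ] using hcode n _ _ h, hcode n _ _⟩
    have h := hφ.setIntegral_preimage_emb
      (MeasurableEquiv.ofInvolutive φ hφφ hφ.measurable).measurableEmbedding G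
      (code n ⁻¹' {code n (φ x)})
    rw [← h, hpre, ← integral_neg]
    exact integral_congr_ae (ae_restrict_of_ae hGφ)
  have hR := hcomp _ measurePreserving_revMap revMap_revMap (fun _ _ _ => code_revMap_congr) hrev
  have hN := hcomp _ measurePreserving_negMap negMap_negMap (fun _ _ _ => code_negMap_congr) hneg
  set z0 : ∀ n, Dig n := fun _ => 0
  have hzero : ∀ n, val n z0 = 0 := fun n => val_eq_zero_iff.2 fun _ _ => rfl
  -- Applying `negMap` and then `revMap` keeps the label and the integral and lowers a nonzero `val
  -- n` by one. Descent to zero links all cells of a label.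
  have hconst : ∀ n v l (y : ∀ n, Dig n), val n y = v →
      ∫ z in code n ⁻¹' {code n (l, y)}, G z ∂spaceMeasure k =
        ∫ z in code n ⁻¹' {code n (l, z0)}, G z ∂spaceMeasure k := by
    intro n v
    induction v with
    | zero =>
      intro l y hy
      rw [code, code, hy, hzero]
    | succ v ih =>
      intro l y hy
      have h1 := hN n (l, y)
      have h2 := hR n (negMap (l, y))
      rw [h1, neg_neg] at h2
      rw [← h2]
      have h3 : (revMap (negMap (l, y)) : Space k) = (l, fun m => (negSeq y m).rev) := by
        simp [revMap, negMap, flipLabel_flipLabel]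
      rw [h3]
      refine ih l _ ?_
      have h4 := val_negSeq (n := n) (y := y) (by omega)
      have h5 := val_rev n (negSeq y)
      omega
  set I : ℕ → Label k → ℝ := fun n l => ∫ z in code n ⁻¹' {code n (l, z0)}, G z ∂spaceMeasure k
  have hIcell : ∀ n (x : Space k),
      ∫ z in code n ⁻¹' {code n x}, G z ∂spaceMeasure k = I n x.1 :=
    fun n x => hconst n _ x.1 x.2 rfl
  have hIflip : ∀ n l, I n (flipLabel l) = -I n l := by
    intro n l
    have := hR n (l, z0)
    rwa [hIcell] at this
  set w : ℕ → ℝ := fun n => (spaceMeasure k).real (code n ⁻¹' {code n ((0, true), z0)})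
  have hwcell : ∀ n (x : Space k), (spaceMeasure k).real (code n ⁻¹' {code n x}) = w n :=
    fun n x => congrArg ENNReal.toReal (spaceMeasure_cell_eq n x _)
  have hw0 : ∀ n, w n ≠ 0 := fun n =>
    ENNReal.toReal_ne_zero.2 ⟨spaceMeasure_cell_ne_zero n _, measure_ne_top _ _⟩
  refine ⟨fun l => I 0 l / w 0, fun l => by simp only [hIflip, neg_div], ?_⟩
  have hγ : Integrable (fun x : Space k => I 0 x.1 / w 0) (spaceMeasure k) := by
    have hm : Measurable fun x : Space k => I 0 x.1 / w 0 :=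
      (measurable_of_countable fun l => I 0 l / w 0).comp measurable_fst
    refine Integrable.of_bound hm.aestronglyMeasurable (∑ l, ‖I 0 l / w 0‖)
      (Filter.Eventually.of_forall fun x => ?_)
    exact Finset.single_le_sum (f := fun l => ‖I 0 l / w 0‖) (fun _ _ => norm_nonneg _)
      (Finset.mem_univ x.1)
  -- A label splits into equally weighted cells of level `n`. Counting them once for `G` and once
  -- for the constant 1 eliminates their number.
  have hratio : ∀ n l, I 0 l * w n = I n l * w 0 := by
    intro n l
    have key : ∀ (H : Space k → ℝ), Integrable H (spaceMeasure k) → ∀ c : ℝ,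
        (∀ x : Space k, x.1 = l → ∫ z in code n ⁻¹' {code n x}, H z ∂spaceMeasure k = c) →
        ∫ z in code 0 ⁻¹' {code 0 (l, z0)}, H z ∂spaceMeasure k =
          (Nat.card (code n '' {x : Space k | x.1 = l}) : ℝ) * c := by
      intro H hH c hc
      have hfin : (code n '' {x : Space k | x.1 = l}).Finite := by
        refine ((finite_Iio (place n)).image fun v => (l, v)).subset ?_
        rintro _ ⟨x, hx, rfl⟩
        exact ⟨val n x.2, val_lt _ _, by rw [code, ← hx.out]⟩
      have := hfin.to_subtype
      have := Fintype.ofFinite (code n '' {x : Space k | x.1 = l})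
      have hU : (code 0 ⁻¹' {code 0 (l, z0)} : Set (Space k)) =
          ⋃ q : code n '' {x : Space k | x.1 = l}, code n ⁻¹' {q.1} := by
        ext x
        simp only [mem_preimage, mem_singleton_iff, mem_iUnion, Subtype.exists]
        constructor
        · intro h
          exact ⟨_, ⟨x, (code_eq_iff.1 h).1, rfl⟩, rfl⟩
        · rintro ⟨_, ⟨z, hz, rfl⟩, h⟩
          have h1 : x.1 = z.1 := (code_eq_iff.1 h).1
          exact code_eq_iff.2 ⟨h1.trans hz, fun m hm => absurd hm (Nat.not_lt_zero m)⟩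
      rw [hU, integral_iUnion (fun q => measurableSet_cell n _) ?_ hH.integrableOn, tsum_fintype]
      · rw [Finset.sum_congr rfl fun q _ => ?_, Finset.sum_const, Finset.card_univ,
          nsmul_eq_mul, Nat.card_eq_fintype_card]
        obtain ⟨_, x, hx, rfl⟩ := q
        exact hc x hx
      · intro q q' hq
        refine Set.disjoint_left.2 fun x hx hx' => hq (Subtype.ext ?_)
        exact hx.symm.trans hx'
    have h1 := key G hG (I n l) fun x hx => by rw [hIcell, hx]
    have h2 := key (fun _ => 1) (integrable_const _) (w n) fun x _ => by
      rw [setIntegral_const, smul_eq_mul, mul_one, hwcell]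
    rw [setIntegral_const, smul_eq_mul, mul_one, hwcell] at h2
    rw [h2, show I 0 l = _ from h1]
    ring
  have := ae_eq_zero_of_setIntegral_cell (hG.sub hγ) fun n x => by
    simp only [Pi.sub_apply]
    rw [integral_sub hG.integrableOn hγ.integrableOn, hIcell,
      setIntegral_congr_fun (g := fun _ => I 0 x.1 / w 0) (measurableSet_cell n _) fun z hz => by
        simp only [(code_eq_iff.1 hz).1],
      setIntegral_const, smul_eq_mul, hwcell, sub_eq_zero]
    have := hw0 0
    field_simp
    linarith [hratio n x.1]
  filter_upwards [this] with x hx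
  exact sub_eq_zero.1 hx

/-- The square integrable, even the integrable, circulations are constant multiples of the
static ones on each label. -/
theorem exists_label_of_circulation (he : ∀ q N, ∃ n, N ≤ n ∧ e n = q)
    (hF : ∀ i, Integrable (F i) (spaceMeasure k))
    (hanti : ∀ i x, F i (colorMap e i x) = -F i x) (hsum : ∀ x, ∑ i, F i x = 0)
    {i j : Fin d} (hi : (i : ℕ) = 0) (hj : (j : ℕ) = 1) :
    ∃ γ : Label k → ℝ, (∀ l, γ (flipLabel l) = -γ l) ∧
      (F i =ᵐ[spaceMeasure k] fun x => γ x.1) ∧ (F j =ᵐ[spaceMeasure k] fun x => -γ x.1) ∧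
      ∀ l : Fin d, 2 ≤ (l : ℕ) → F l =ᵐ[spaceMeasure k] 0 := by
  have hl : ∀ l : Fin d, 2 ≤ (l : ℕ) → F l =ᵐ[spaceMeasure k] 0 :=
    fun l hl => ae_eq_zero_of_two_le he hF hanti hsum hl
  have hij : i ≠ j := by rintro rfl; omega
  -- Only the two static edges at a vertex carry flow, so conservation makes their values opposite.
  have hadd : ∀ᵐ x ∂spaceMeasure k, F j x = -F i x := by
    have : ∀ᵐ x ∂spaceMeasure k, ∀ l : Fin d, 2 ≤ (l : ℕ) → F l x = 0 :=
      ae_all_iff.2 fun l => by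
        by_cases h : 2 ≤ (l : ℕ)
        · filter_upwards [hl l h] with x hx _ using hx
        · exact Filter.Eventually.of_forall fun x h' => absurd h' h
    filter_upwards [this] with x hx
    have := hsum x
    rw [Fintype.sum_eq_add i j hij] at this
    · linarith
    · rintro l ⟨h1, h2⟩
      refine hx l ?_
      by_contra h
      rcases (by omega : (l : ℕ) = 0 ∨ (l : ℕ) = 1) with h | h
      exacts [h1 (Fin.ext (h.trans hi.symm)), h2 (Fin.ext (h.trans hj.symm))]
  obtain ⟨γ, hγ, hFi⟩ := ae_eq_label_of_neg (hF i)
    (Filter.Eventually.of_forall fun x => by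
      rw [← colorMap_of_eq_zero e hi]; exact hanti i x)
    (by
      -- Antisymmetry along color `j` passes to `F i` by using the relation at both ends of the
      -- edge.
      have h2 := (measurePreserving_colorMap e j).quasiMeasurePreserving.ae hadd
      filter_upwards [hadd, h2] with x hx hx'
      rw [hanti j x, colorMap_of_eq_one e hj] at hx'
      linarith)
  refine ⟨γ, hγ, hFi, ?_, hl⟩
  filter_upwards [hadd, hFi] with x hx hx'
  rw [hx, hx']

end Integral

/-! ### Acyclicity -/

section Graph

theorem SimpleGraph.Walk.invariant {V : Type*} {G : SimpleGraph V} {u v : V} (w : G.Walk u v)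
    (P : V → Prop) (hP : ∀ p q, G.Adj p q → s(p, q) ∈ w.edges → p ∈ w.support →
      q ∈ w.support → P p → P q) (hu : P u) : P v := by
  induction w with
  | nil => exact hu
  | cons h w ih =>
    refine ih (fun p q hpq he hp hq => hP p q hpq ?_ ?_ ?_) (hP _ _ h ?_ ?_ ?_ hu)
    · rw [edges_cons]; exact List.mem_cons_of_mem _ he
    · rw [support_cons]; exact List.mem_cons_of_mem _ hp
    · rw [support_cons]; exact List.mem_cons_of_mem _ hq
    · rw [edges_cons]; exact List.mem_cons_self
    · rw [support_cons]; exact List.mem_cons_self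
    · rw [support_cons]; exact List.mem_cons_of_mem _ w.start_mem_support

/-- The graph whose edges join the points to their images under some involutions. -/
def involutionGraph {ι Y : Type*} (s : ι → Y → Y) (hs : ∀ i y, s i (s i y) = y)
    (hne : ∀ i y, s i y ≠ y) : SimpleGraph Y where
  Adj x y := ∃ i, s i x = y
  symm := ⟨by rintro x _ ⟨i, rfl⟩; exact ⟨i, hs i x⟩⟩
  loopless := ⟨fun x ⟨i, h⟩ => hne i x h⟩

end Graph

/-! ### Finite paths approximating the static lines. -/

section Position

variable {k d : ℕ}

/-- The position on the path that is traced out by the two static involutions on the numbers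
below `M`. -/
def pathPosition (M v : ℕ) : ℕ := if 2 * v < M then 2 * v else 2 * (M - v) - 1

theorem pathPosition_inj {M v w : ℕ} (hv : v < M) (hw : w < M)
    (h : pathPosition M v = pathPosition M w) : v = w := by
  unfold pathPosition at h
  split_ifs at h <;> omega

theorem two_dvd_place {n : ℕ} (hn : n ≠ 0) : 2 ∣ place n := by
  obtain ⟨m, rfl⟩ := Nat.exists_eq_succ_of_ne_zero hn
  rw [place, mul_left_comm]
  exact dvd_mul_right _ _

/-- The path is `0, M - 1, 1, M - 2, ...`, whose edges are alternately reversals and negations.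
Evenness of `M` excludes a middle point fixed by reversal; negation fixes just the two ends. -/
theorem pathPosition_rev {M v w : ℕ} (hM : 2 ∣ M) (h : w + v + 1 = M) :
    pathPosition M w = pathPosition M v + 1 ∨ pathPosition M v = pathPosition M w + 1 := by
  unfold pathPosition
  split_ifs <;> omega

theorem pathPosition_neg {M v w : ℕ} (h : w + v = M) (hv : v ≠ 0) (hw : w ≠ 0)
    (hne : 2 * v ≠ M) :
    pathPosition M w = pathPosition M v + 1 ∨ pathPosition M v = pathPosition M w + 1 := by
  unfold pathPosition
  split_ifs <;> omega

theorem eventually_val_ne_zero {y : ∀ n, Dig n} (hy : ∃ n, val n y ≠ 0) :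
    ∀ᶠ n in Filter.atTop, val n y ≠ 0 := by
  obtain ⟨m, hm⟩ := hy
  exact Filter.eventually_atTop.2 ⟨m, fun n hn => val_ne_zero_mono hn hm⟩

/-- At the other end of the path all digits but the top one vanish, because half of `place (j + 1)`
is a multiple of `place j`. -/
theorem eventually_two_mul_val_ne {y : ∀ n, Dig n} (hy : ∃ n, val n y ≠ 0) :
    ∀ᶠ n in Filter.atTop, 2 * val n y ≠ place n := by
  obtain ⟨m, hm⟩ := hy
  refine Filter.eventually_atTop.2 ⟨m + 1, fun n hn h => ?_⟩
  obtain ⟨j, rfl⟩ := Nat.exists_eq_succ_of_ne_zero (by omega : n ≠ 0)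
  refine val_ne_zero_mono (by omega : m ≤ j) hm ?_
  rw [Nat.succ_eq_add_one, val_succ, place] at h
  have h1 : val j y + (y j : ℕ) * place j = 2 ^ j * place j := by linarith
  have h2 : place j ∣ val j y :=
    (Nat.dvd_add_left (dvd_mul_left _ _)).1 (h1 ▸ dvd_mul_left _ _)
  exact Nat.eq_zero_of_dvd_of_lt h2 (val_lt y j)

/-- The position of a vertex along the finite path approximating its static line. -/
def position (n : ℕ) (x : Space k) : ℕ := pathPosition (place n) (val n x.2)

theorem code_eq_of_position {n : ℕ} {x z : Space k} (h1 : x.1 = z.1)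
    (h2 : position n x = position n z) : code n x = code n z :=
  Prod.ext h1 (pathPosition_inj (val_lt _ _) (val_lt _ _) h2)

variable (e : ℕ → Fin d × ℕ × (Label k × ℕ))

theorem colorMap_fst_of_lt_two {i : Fin d} (hi : (i : ℕ) < 2) (x : Space k) :
    (colorMap e i x).1 = flipLabel x.1 := by
  rcases (by omega : (i : ℕ) = 0 ∨ (i : ℕ) = 1) with h | h
  · rw [colorMap_of_eq_zero e h]; rfl
  · rw [colorMap_of_eq_one e h]; rfl

theorem position_colorMap {i : Fin d} (hi : (i : ℕ) < 2) {n : ℕ} (hn : n ≠ 0) {x : Space k}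
    (h0 : val n x.2 ≠ 0) (h1 : 2 * val n x.2 ≠ place n) :
    position n (colorMap e i x) = position n x + 1 ∨
      position n x = position n (colorMap e i x) + 1 := by
  rcases (by omega : (i : ℕ) = 0 ∨ (i : ℕ) = 1) with h | h
  · rw [colorMap_of_eq_zero e h]
    exact pathPosition_rev (two_dvd_place hn) (val_rev n x.2)
  · rw [colorMap_of_eq_one e h]
    have h2 := val_negSeq h0
    have h3 := val_lt x.2 n
    exact pathPosition_neg h2 h0 (by dsimp only [negMap]; omega) h1

end Position

/-! ### Local structure at good points. -/

section Good

variable {k d : ℕ} (e : ℕ → Fin d × ℕ × (Label k × ℕ))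

/-- The points at which the approximations to all the involutions stabilize. -/
structure IsGood (x : Space k) : Prop where
  val_ne_zero : ∃ n, val n x.2 ≠ 0
  calm : ∀ i : Fin d, ∃ n, x ∈ calm e i n

theorem measurableSet_isGood : MeasurableSet {x : Space k | IsGood e x} := by
  have : {x : Space k | IsGood e x} =
      (⋃ n, {x | val n x.2 = 0}ᶜ) ∩ ⋂ i, ⋃ n, calm e i n := by
    ext x
    simp only [mem_ofPred_eq, mem_inter_iff, mem_iUnion, mem_iInter, mem_compl_iff]
    exact ⟨fun h => ⟨h.1, h.2⟩, fun h => ⟨h.1, h.2⟩⟩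
  rw [this]
  exact (MeasurableSet.iUnion fun n => (measurableSet_val_eq_zero n).compl).inter
    (.iInter fun i => .iUnion fun n => measurableSet_calm e i n)

theorem ae_isGood : ∀ᵐ x ∂spaceMeasure k, IsGood e x := by
  filter_upwards [ae_val_ne_zero, ae_all_iff.2 fun i => ae_mem_iUnion_calm e i] with x h1 h2
  exact ⟨h1, fun i => mem_iUnion.1 (h2 i)⟩

variable {e} {x : Space k}

theorem colorMap_ne (hx : IsGood e x) (i : Fin d) : colorMap e i x ≠ x := by
  intro h
  by_cases hi : (i : ℕ) < 2
  · obtain ⟨n, h0, h1, hn⟩ := ((eventually_val_ne_zero hx.1).and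
      ((eventually_two_mul_val_ne hx.1).and (Filter.eventually_ne_atTop 0))).exists
    have := position_colorMap e hi hn h0 h1
    rw [h] at this
    omega
  · obtain ⟨n, hn⟩ := hx.2 i
    -- `code_stage_ne` needs a positive level.
    have hn' := calm_mono e i (Nat.le_succ n) hn
    have h1 := code_limitMap e i hn'
    rw [← colorMap_of_two_le e (by omega), h] at h1
    exact code_stage_ne e i n.succ_pos x h1.symm

/-- Around any finite set of good points, some tent function changes along a given edge of color
at least two, but along no other edge. -/
theorem exists_height_colorMap (he : ∀ q N, ∃ n, N ≤ n ∧ e n = q) (hx : IsGood e x) {i : Fin d}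
    (hi : 2 ≤ (i : ℕ)) {S : Set (Space k)} (hS : S.Finite) (hSg : ∀ p ∈ S, IsGood e p) :
    ∃ n, height n (colorMap e i x) ≠ height n x ∧
      ∀ p ∈ S, ∀ j, (j = i → p ≠ x ∧ p ≠ colorMap e i x) →
        height n (colorMap e j p) = height n p := by
  classical
  have hsep : ∀ p, ∀ᶠ n in Filter.atTop, p ≠ x → code n p ≠ code n x := by
    intro p
    by_cases h : p = x
    · exact Filter.Eventually.of_forall fun n h' => absurd h h'
    · obtain ⟨N, hN⟩ := exists_code_ne h
      exact Filter.eventually_atTop.2 ⟨N, fun n hn _ => hN n hn⟩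
  obtain ⟨a, ha⟩ := hx.2 i
  obtain ⟨N, h1, h2, h3, h4⟩ := (((Filter.eventually_all_finite hS).2 fun p hp =>
      eventually_val_ne_zero (hSg p hp).1).and
    (((Filter.eventually_all_finite hS).2 fun p _ => hsep p).and
    (((Filter.eventually_all_finite hS).2 fun p _ => hsep (colorMap e i p)).and
    (hsep (colorMap e i x))))).exists
  -- At level `N` the cell of `x` contains no other point of `S` and no image under color `i`
  -- different from `x`. Scheduling this cell for color `i`, after `x` has become calm, singles out
  -- the edge.
  obtain ⟨n, hn, hen⟩ := he (i, N, code N x) (max N a)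
  have hNn : N ≤ n := (le_max_left _ _).trans hn
  have htarget : ∀ p, p ∈ target e n ↔ code N p = code N x := fun p => by
    simp [target, hen, hNn]
  have hlim := colorMap_of_two_le e hi
  refine ⟨n, ?_, fun p hp j hj => ?_⟩
  · have hcalm : ∀ m, n ≤ m → ¬ Jumps e i m x := calm_mono e i ((le_max_right _ _).trans hn) ha
    rw [hlim, height_limitMap, if_pos hcalm,
      increment, if_pos (by rw [hen]), ← hlim, indicator_of_mem ((htarget x).2 rfl),
      indicator_of_notMem (mt (htarget _).1 (h4 (colorMap_ne hx i)))]
    simp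
  · by_cases hji : j = i
    · subst hji
      obtain ⟨hpx, hpx'⟩ := hj rfl
      have hpx'' : colorMap e j p ≠ x := fun h => hpx' (by rw [← h, colorMap_colorMap])
      rw [hlim, height_limitMap, ← hlim, increment,
        indicator_of_notMem (mt (htarget _).1 (h2 p hp hpx)),
        indicator_of_notMem (mt (htarget _).1 (h3 p hp hpx''))]
      simp
    · by_cases hj1 : (j : ℕ) = 1
      · rw [colorMap_of_eq_one e hj1, height_negMap (val_ne_zero_mono hNn (h1 p hp))]
      · exact height_colorMap_of_ne e hj1 (by rw [hen]; exact Ne.symm hji) p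

/-- Digit 0 takes two values, which reversal exchanges and negation fixes. -/
theorem revMap_ne_negMap (x : Space k) : revMap x ≠ negMap x := by
  intro h
  have h1 : ((revMap x).2 0 : ℕ) = (negMap x).2 0 := by rw [h]
  have h2 := (x.2 0).isLt
  simp only [revMap, negMap, Fin.val_rev] at h1
  rw [negSeq, if_pos (by simp), negDig_val] at h1
  split_ifs at h1 <;> omega

/-- If the larger color is at least 2, some tent function changes along it and not along the other.
-/
theorem colorMap_injective (he : ∀ q N, ∃ n, N ≤ n ∧ e n = q) (hx : IsGood e x) {i j : Fin d}
    (h : colorMap e i x = colorMap e j x) : i = j := by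
  by_contra hij
  wlog hle : (i : ℕ) ≤ j generalizing i j
  · exact this h.symm (Ne.symm hij) (by omega)
  have hlt : (i : ℕ) < j := lt_of_le_of_ne hle fun h' => hij (Fin.ext h')
  by_cases hj : 2 ≤ (j : ℕ)
  · obtain ⟨n, h1, h2⟩ := exists_height_colorMap he hx hj (finite_singleton x)
      (by rintro p rfl; exact hx)
    exact h1 (by rw [← h]; exact h2 x rfl i fun h' => absurd h' hij)
  · rw [colorMap_of_eq_zero e (by omega), colorMap_of_eq_one e (by omega)] at h
    exact revMap_ne_negMap x h

end Good

/-! ### Bridges and absence of cycles. -/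

section Acyclic

variable {k d : ℕ} {e : ℕ → Fin d × ℕ × (Label k × ℕ)} {Y : Type*} {ι : Y → Space k}
  {s : Fin d → Y → Y}

/-- A walk between the ends that avoids the edge would preserve a tent function taking different
values at the two ends. -/
theorem isBridge_of_two_le (he : ∀ q N, ∃ n, N ≤ n ∧ e n = q) (hι : Function.Injective ι)
    (hgood : ∀ y, IsGood e (ι y)) (hs : ∀ i y, ι (s i y) = colorMap e i (ι y))
    (hss : ∀ i y, s i (s i y) = y) (hne : ∀ i y, s i y ≠ y) {i : Fin d} (hi : 2 ≤ (i : ℕ))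
    (a : Y) : (involutionGraph s hss hne).IsBridge s(a, s i a) := by
  rw [SimpleGraph.isBridge_iff_forall_walk_mem_edges]
  intro w
  by_contra hw
  obtain ⟨n, h1, h2⟩ := exists_height_colorMap he (hgood a) hi
    ((w.support.finite_toSet).image ι) (by rintro _ ⟨y, -, rfl⟩; exact hgood y)
  refine h1 ?_
  rw [← hs]
  refine w.invariant (fun p => height n (ι p) = height n (ι a)) ?_ rfl
  rintro p _ ⟨j, rfl⟩ hedge hp - hpa
  rw [hs, h2 _ ⟨p, hp, rfl⟩, hpa]
  rintro rfl
  refine ⟨fun h => hw ?_, fun h => hw ?_⟩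
  · rwa [hι h] at hedge
  · rw [← hs] at h
    rwa [hι h, hss, Sym2.eq_swap] at hedge

/-- For suitable large `n`, positions along the walk change by one, and position with label
identifies `a` and `b` among its vertices. The walk starts at `b` and cannot get below the position
of `b` except by stepping from `b` to `a`. Positions do not record labels, so the invariant tracks
these by the number of flips. -/
theorem mem_edges_of_position_lt (hι : Function.Injective ι)
    (hgood : ∀ y, IsGood e (ι y)) (hs : ∀ i y, ι (s i y) = colorMap e i (ι y))
    {H : SimpleGraph Y} (hH : ∀ {p q}, H.Adj p q → ∃ j : Fin d, (j : ℕ) < 2 ∧ s j p = q)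
    {a b : Y} (hab : H.Adj a b)
    (hpos : ∃ᶠ n in Filter.atTop, position n (ι b) = position n (ι a) + 1)
    (w : H.Walk b a) : s(a, b) ∈ w.edges := by
  by_contra hw
  have hsep : ∀ c : Y, ∀ p : Y, ∀ᶠ n in Filter.atTop, code n (ι p) = code n (ι c) → p = c := by
    intro c p
    by_cases h : p = c
    · exact Filter.Eventually.of_forall fun n _ => h
    · obtain ⟨N, hN⟩ := exists_code_ne (hι.ne h)
      exact Filter.eventually_atTop.2 ⟨N, fun n hn h' => absurd h' (hN n hn)⟩
  have hfin : {p | p ∈ w.support}.Finite := w.support.finite_toSet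
  obtain ⟨n, hn, h1, h2, h3, h4, hn0⟩ := (hpos.and_eventually
    (((Filter.eventually_all_finite hfin).2 fun p _ => eventually_val_ne_zero (hgood p).1).and
    (((Filter.eventually_all_finite hfin).2 fun p _ => eventually_two_mul_val_ne (hgood p).1).and
    (((Filter.eventually_all_finite hfin).2 fun p _ => hsep a p).and
    (((Filter.eventually_all_finite hfin).2 fun p _ => hsep b p).and
    (Filter.eventually_ne_atTop 0)))))).exists
  have hlabel : ∀ {p q}, H.Adj p q → (ι q).1 = flipLabel (ι p).1 := by
    intro p q hpq
    obtain ⟨j, hj, rfl⟩ := hH hpq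
    rw [hs, colorMap_fst_of_lt_two e hj]
  have := w.invariant (fun p => ∃ m, position n (ι p) = position n (ι b) + m ∧
    (ι p).1 = flipLabel^[m] (ι b).1) ?_ ⟨0, rfl, rfl⟩
  · obtain ⟨m, hm, -⟩ := this
    omega
  · rintro p q hpq hedge hp hq ⟨m, hm, hl⟩
    have hstep : position n (ι q) = position n (ι p) + 1 ∨
        position n (ι p) = position n (ι q) + 1 := by
      obtain ⟨j, hj, rfl⟩ := hH hpq
      rw [hs]
      exact position_colorMap e hj hn0 (h1 p hp) (h2 p hp)
    rcases hstep with hstep | hstep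
    · exact ⟨m + 1, by omega, by rw [Function.iterate_succ_apply', ← hl, hlabel hpq]⟩
    · cases m with
      | zero =>
        have hpb : p = b := h4 p hp (code_eq_of_position hl (by omega))
        subst hpb
        have hqa : q = a := h3 q hq (code_eq_of_position
          (by rw [hlabel hpq, ← hlabel hab.symm]) (by omega))
        subst hqa
        rw [Sym2.eq_swap] at hedge
        exact absurd hedge hw
      | succ m =>
        refine ⟨m, by omega, ?_⟩
        rw [hlabel hpq, hl, Function.iterate_succ_apply', flipLabel_flipLabel]

theorem isAcyclic_static (hι : Function.Injective ι)
    (hgood : ∀ y, IsGood e (ι y)) (hs : ∀ i y, ι (s i y) = colorMap e i (ι y))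
    {H : SimpleGraph Y} (hH : ∀ {p q}, H.Adj p q → ∃ j : Fin d, (j : ℕ) < 2 ∧ s j p = q) :
    H.IsAcyclic := by
  rw [SimpleGraph.isAcyclic_iff_forall_adj_isBridge]
  intro a b hab
  have hstep : ∀ᶠ n in Filter.atTop, position n (ι b) = position n (ι a) + 1 ∨
      position n (ι a) = position n (ι b) + 1 := by
    obtain ⟨j, hj, rfl⟩ := hH hab
    filter_upwards [eventually_val_ne_zero (hgood a).1, eventually_two_mul_val_ne (hgood a).1,
      Filter.eventually_ne_atTop 0] with n h0 h1 hn
    rw [hs]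
    exact position_colorMap e hj hn h0 h1
  rw [SimpleGraph.isBridge_iff_forall_walk_mem_edges]
  intro w
  -- Which end is further along may depend on `n`, but one of the two orders occurs infinitely
  -- often.
  rcases Filter.frequently_or_distrib.1 hstep.frequently with h | h
  · have := mem_edges_of_position_lt hι hgood hs hH hab h w.reverse
    rwa [SimpleGraph.Walk.edges_reverse, List.mem_reverse] at this
  · rw [Sym2.eq_swap]
    exact mem_edges_of_position_lt hι hgood hs hH hab.symm h w

/-- A cycle contains no bridge, so it would consist of static edges only. -/
theorem isAcyclic_involutionGraph (he : ∀ q N, ∃ n, N ≤ n ∧ e n = q)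
    (hι : Function.Injective ι)
    (hgood : ∀ y, IsGood e (ι y)) (hs : ∀ i y, ι (s i y) = colorMap e i (ι y))
    (hss : ∀ i y, s i (s i y) = y) (hne : ∀ i y, s i y ≠ y) :
    (involutionGraph s hss hne).IsAcyclic := by
  intro x c hc
  let H : SimpleGraph Y :=
    involutionGraph (fun j : {j : Fin d // (j : ℕ) < 2} => s j) (fun j => hss j) fun j => hne j
  have hcH : ∀ edge ∈ c.edges, edge ∈ H.edgeSet := by
    intro edge hedge
    induction edge with
    | h p q =>
      obtain ⟨i, rfl⟩ := c.adj_of_mem_edges hedge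
      by_cases hi : (i : ℕ) < 2
      · exact ⟨⟨i, hi⟩, rfl⟩
      · exact absurd hedge
          ((isBridge_of_two_le he hι hgood hs hss hne (by omega) p).notMem_edges_of_isCycle hc)
  refine isAcyclic_static hι hgood hs (H := H) ?_ _ (hc.transfer hcH)
  rintro p q ⟨j, rfl⟩
  exact ⟨j, j.2, rfl⟩

end Acyclic

/-! ### Graphings defined by involutions -/

theorem measurable_graphMap {Y : Type*} [MeasurableSpace Y] {f : Y → Y} (hf : Measurable f) :
    Measurable fun x => (x, f x) :=
  measurable_id.prodMk hf

section InvolutionGraph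

variable {d : ℕ} {Y : Type*} {s : Fin d → Y → Y}
  {hss : ∀ i y, s i (s i y) = y} {hne : ∀ i y, s i y ≠ y}

/-- The neighbors of a vertex are indexed by the involutions. -/
noncomputable def neighborEquiv (hinj : ∀ x i j, s i x = s j x → i = j) (x : Y) :
    Fin d ≃ (involutionGraph s hss hne).neighborSet x :=
  Equiv.ofBijective (fun i => ⟨s i x, i, rfl⟩)
    ⟨fun i j h => hinj x i j (congrArg Subtype.val h),
      fun ⟨_, i, h⟩ => ⟨i, Subtype.ext h⟩⟩

theorem isCirculation_iff (hinj : ∀ x i j, s i x = s j x → i = j)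
    {f : Y → Y → ℝ} :
    Graphing.IsCirculation (involutionGraph s hss hne) f ↔
      (∀ i x, f (s i x) x = -f x (s i x)) ∧ ∀ x, ∑ i, f x (s i x) = 0 := by
  have hflow : ∀ x, HasSum (fun y : (involutionGraph s hss hne).neighborSet x => f x y) 0 ↔
      ∑ i, f x (s i x) = 0 := by
    intro x
    rw [← (neighborEquiv (hss := hss) (hne := hne) hinj x).hasSum_iff]
    exact ⟨fun h => (hasSum_fintype _).unique h, fun h => h ▸ hasSum_fintype _⟩
  constructor
  · rintro ⟨h1, h2⟩
    exact ⟨fun i x => h1 _ _ ⟨i, rfl⟩, fun x => (hflow x).1 (h2 x)⟩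
  · rintro ⟨h1, h2⟩
    refine ⟨?_, fun x => (hflow x).2 (h2 x)⟩
    rintro x _ ⟨i, rfl⟩
    exact h1 i x

end InvolutionGraph

section Involutions

variable {d : ℕ} {Y : Type*} [MeasurableSpace Y] [StandardBorelSpace Y] {s : Fin d → Y → Y}

/-- The graphing defined by finitely many measure preserving involutions. -/
def involutionGraphing (hss : ∀ i y, s i (s i y) = y) (hne : ∀ i y, s i y ≠ y)
    (ν : Measure Y) (hν : IsProbabilityMeasure ν) (hs : ∀ i, MeasurePreserving (s i) ν ν) :
    Graphing Y where
  graph := involutionGraph s hss hne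
  vertexMeasure := ν
  isProbabilityMeasure := hν
  exists_pmp := by
    refine ⟨fun n => if n < d then univ else ∅, fun n => if h : n < d then s ⟨n, h⟩ else id,
      fun n => ?_, fun x y => ?_⟩
    · by_cases h : n < d
      · simp only [h, if_true, dif_pos]
        refine ⟨.univ, (hs _).measurable, ?_, fun S _ hS => ?_⟩
        · exact (Function.LeftInverse.injective (hss _)).injOn
        · rw [Set.image_eq_preimage_of_inverse (hss _) (hss _)]
          exact (hs _).measure_preimage hS.nullMeasurableSet
      · simp only [h, if_false, dif_neg, not_false_eq_true]
        exact ⟨.empty, measurable_id, injOn_empty _, fun S hS _ => by simp⟩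
    · constructor
      · rintro ⟨i, rfl⟩
        exact ⟨i, by simp⟩
      · rintro ⟨n, hn, rfl⟩
        by_cases h : n < d
        · exact ⟨⟨n, h⟩, by simp [h]⟩
        · simp [h] at hn

variable {hss : ∀ i y, s i (s i y) = y} {hne : ∀ i y, s i y ≠ y}
  {ν : Measure Y} {hν : IsProbabilityMeasure ν} {hs : ∀ i, MeasurePreserving (s i) ν ν}
theorem isRegular_involutionGraphing (hinj : ∀ x i j, s i x = s j x → i = j) :
    (involutionGraphing hss hne ν hν hs).IsRegular d := by
  intro x
  change ((involutionGraph s hss hne).neighborSet x).encard = d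
  rw [Set.encard, ← ENat.card_congr (neighborEquiv (hss := hss) (hne := hne) hinj x)]
  simp

theorem edgeMeasure_involutionGraphing (hinj : ∀ x i j, s i x = s j x → i = j) :
    (involutionGraphing hss hne ν hν hs).edgeMeasure d =
      (d : ℝ≥0∞)⁻¹ • ∑ i, ν.map fun x => (x, s i x) := by
  classical
  ext S hS
  have hm := fun i => measurable_graphMap (hs i).measurable
  have hdeg : ∀ x, (involutionGraphing hss hne ν hν hs).degIn S x =
      ∑ i, ((fun x => (x, s i x)) ⁻¹' S).indicator 1 x := by
    intro x
    have h : {y | (involutionGraphing hss hne ν hν hs).graph.Adj x y ∧ (x, y) ∈ S} =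
        (fun i => s i x) '' {i | (x, s i x) ∈ S} := by
      ext y
      constructor
      · rintro ⟨⟨i, rfl⟩, h⟩
        exact ⟨i, h, rfl⟩
      · rintro ⟨i, h, rfl⟩
        exact ⟨⟨i, rfl⟩, h⟩
    rw [Graphing.degIn, h, InjOn.encard_image fun i _ j _ hij => hinj x i j hij,
      Graphing.encard_eq_tsum_indicator, tsum_fintype]
    refine Finset.sum_congr rfl fun i _ => ?_
    simp [indicator_apply]
  rw [Graphing.edgeMeasure, Measure.smul_apply, Measure.ofMeasurable_apply S hS,
    Measure.smul_apply, Measure.finsetSum_apply]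
  congr 1
  simp only [hdeg]
  rw [lintegral_finsetSum _ fun i _ => measurable_one.indicator ((hm i) hS)]
  refine Finset.sum_congr rfl fun i _ => ?_
  rw [lintegral_indicator_one ((hm i) hS), Measure.map_apply (hm i) hS]
  rfl

/-- The edge measure is the average of the measures carried by the colors. This domination transfers
null sets and square integrability to each color. -/
theorem map_le_smul_edgeMeasure (hinj : ∀ x i j, s i x = s j x → i = j)
    (i : Fin d) :
    (ν.map fun x => (x, s i x)) ≤
      (d : ℝ≥0∞) • (involutionGraphing hss hne ν hν hs).edgeMeasure d := by
  have hd : (d : ℝ≥0∞) ≠ 0 := by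
    have := i.pos
    exact_mod_cast this.ne'
  rw [edgeMeasure_involutionGraphing hinj, smul_smul,
    ENNReal.mul_inv_cancel hd (ENNReal.natCast_ne_top d), one_smul]
  exact Finset.single_le_sum (f := fun i => ν.map fun x => (x, s i x)) (fun _ _ => Measure.zero_le _)
    (Finset.mem_univ i)

theorem ae_of_ae_edgeMeasure (hinj : ∀ x i j, s i x = s j x → i = j)
    {P : Y × Y → Prop}
    (h : ∀ᵐ p ∂(involutionGraphing hss hne ν hν hs).edgeMeasure d, P p) (i : Fin d) :
    ∀ᵐ x ∂ν, P (x, s i x) := by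
  have h1 := (Measure.absolutelyContinuous_of_le_smul
    (map_le_smul_edgeMeasure (hss := hss) (hne := hne) (hν := hν) (hs := hs) hinj i)).ae_le h
  exact ae_of_ae_map (measurable_graphMap (hs i).measurable).aemeasurable h1

theorem ae_edgeMeasure_of_forall (hinj : ∀ x i j, s i x = s j x → i = j)
    {P : Y × Y → Prop} (hP : MeasurableSet {p | P p})
    (h : ∀ i, ∀ᵐ x ∂ν, P (x, s i x)) :
    ∀ᵐ p ∂(involutionGraphing hss hne ν hν hs).edgeMeasure d, P p := by
  rw [edgeMeasure_involutionGraphing hinj]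
  refine Measure.ae_smul_measure ?_ _
  rw [ae_iff, Measure.finsetSum_apply]
  refine Finset.sum_eq_zero fun i _ => ?_
  exact (ae_map_iff (measurable_graphMap (hs i).measurable).aemeasurable hP).2 (h i)

theorem isFiniteMeasure_edgeMeasure (hinj : ∀ x i j, s i x = s j x → i = j)
    (hd : d ≠ 0) :
    IsFiniteMeasure ((involutionGraphing hss hne ν hν hs).edgeMeasure d) := by
  rw [edgeMeasure_involutionGraphing hinj]
  have : IsFiniteMeasure (∑ i, ν.map fun x => (x, s i x)) := inferInstance
  exact Measure.smul_finite _ (ENNReal.inv_ne_top.2 (by exact_mod_cast hd))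

theorem integrable_of_memLp (hinj : ∀ x i j, s i x = s j x → i = j)
    {u : Y × Y → ℝ}
    (hu : MemLp u 2 ((involutionGraphing hss hne ν hν hs).edgeMeasure d)) (i : Fin d) :
    Integrable (fun x => u (x, s i x)) ν := by
  have h1 : MemLp u 2 (ν.map fun x => (x, s i x)) :=
    hu.of_measure_le_smul (ENNReal.natCast_ne_top d) (map_le_smul_edgeMeasure hinj i)
  have h2 := h1.comp_of_map (measurable_graphMap (hs i).measurable).aemeasurable
  exact h2.integrable one_le_two

theorem measurableSet_snd_eq {f : Y → Y} (hf : Measurable f) :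
    MeasurableSet {p : Y × Y | p.2 = f p.1} := by
  let _ := upgradeStandardBorel Y
  exact measurableSet_eq_fun measurable_snd (hf.comp measurable_fst)

end Involutions

/-! ### The graphing with a prescribed dimension of circulations -/

/-- The first component of the unpairing is a dummy index, which makes every value recur. -/
theorem exists_recurrent_sequence (Q : Type*) [Countable Q] [Nonempty Q] :
    ∃ e : ℕ → Q, ∀ q N, ∃ n, N ≤ n ∧ e n = q := by
  obtain ⟨g, hg⟩ := exists_surjective_nat Q
  refine ⟨fun n => g n.unpair.2, fun q N => ?_⟩
  obtain ⟨a, rfl⟩ := hg q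
  exact ⟨Nat.pair N a, Nat.left_le_pair N a, by simp⟩

/-! ### Restriction to an invariant conull set. -/

section Domain

variable {k d : ℕ} (e : ℕ → Fin d × ℕ × (Label k × ℕ))

/-- The points all of whose images under words in the involutions are good. -/
def goodSet : Set (Space k) :=
  {x | ∀ w : List (Fin d), IsGood e (w.foldr (colorMap e) x)}

theorem measurableSet_goodSet : MeasurableSet (goodSet e) := by
  have hw : ∀ w : List (Fin d), Measurable fun x : Space k => w.foldr (colorMap e) x := by
    intro w
    induction w with
    | nil => exact measurable_id
    | cons i w ih => exact (measurePreserving_colorMap e i).measurable.comp ih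
  have : goodSet e = ⋂ w : List (Fin d),
      (fun x => w.foldr (colorMap e) x) ⁻¹' {x | IsGood e x} := by
    ext x; simp [goodSet]
  rw [this]
  exact .iInter fun w => hw w (measurableSet_isGood e)

theorem ae_mem_goodSet : ∀ᵐ x ∂spaceMeasure k, x ∈ goodSet e := by
  refine ae_all_iff.2 fun w => ?_
  have hw : MeasurePreserving (fun x : Space k => w.foldr (colorMap e) x)
      (spaceMeasure k) (spaceMeasure k) := by
    induction w with
    | nil => exact MeasurePreserving.id _
    | cons i w ih => exact (measurePreserving_colorMap e i).comp ih
  exact hw.quasiMeasurePreserving.ae (ae_isGood e)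

theorem colorMap_mem_goodSet {x : Space k} (hx : x ∈ goodSet e) (i : Fin d) :
    colorMap e i x ∈ goodSet e := by
  intro w
  have := hx (w ++ [i])
  rwa [List.foldr_append] at this

/-- The restriction of an involution to the good set. -/
noncomputable def goodMap (i : Fin d) (x : goodSet e) : goodSet e :=
  ⟨colorMap e i x, colorMap_mem_goodSet e x.2 i⟩

theorem goodMap_goodMap (i : Fin d) (x : goodSet e) : goodMap e i (goodMap e i x) = x :=
  Subtype.ext (colorMap_colorMap e i x)

theorem isGood_coe (x : goodSet e) : IsGood e (x : Space k) := x.2 []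

theorem goodMap_ne (i : Fin d) (x : goodSet e) : goodMap e i x ≠ x :=
  fun h => colorMap_ne (isGood_coe e x) i (congrArg Subtype.val h)

/-- The measure on the good set. -/
noncomputable def goodMeasure : Measure (goodSet e) := (spaceMeasure k).comap Subtype.val

theorem map_goodMeasure : (goodMeasure e).map Subtype.val = spaceMeasure k := by
  rw [goodMeasure, map_comap_subtype_coe (measurableSet_goodSet e)]
  exact Measure.restrict_eq_self_of_ae_mem (ae_mem_goodSet e)

theorem isProbabilityMeasure_goodMeasure : IsProbabilityMeasure (goodMeasure e) := by
  have h : IsProbabilityMeasure ((goodMeasure e).map Subtype.val) := by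
    rw [map_goodMeasure]; infer_instance
  exact Measure.isProbabilityMeasure_of_map Subtype.val

theorem ae_goodMeasure_iff {P : Space k → Prop} :
    (∀ᵐ x : goodSet e ∂goodMeasure e, P x) ↔ ∀ᵐ x ∂spaceMeasure k, P x := by
  rw [← map_goodMeasure e, (MeasurableEmbedding.subtype_coe
    (measurableSet_goodSet e)).ae_map_iff]

theorem measurePreserving_goodMap (i : Fin d) :
    MeasurePreserving (goodMap e i) (goodMeasure e) (goodMeasure e) := by
  have hemb := MeasurableEmbedding.subtype_coe (measurableSet_goodSet e)
  have hm : Measurable (goodMap e i) :=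
    ((measurePreserving_colorMap e i).measurable.comp measurable_subtype_coe).subtype_mk
  refine ⟨hm, Measure.ext fun A hA => ?_⟩
  rw [Measure.map_apply hm hA, goodMeasure, hemb.comap_apply, hemb.comap_apply,
    ← (measurePreserving_colorMap e i).measure_preimage
      (hemb.measurableSet_image' hA).nullMeasurableSet]
  congr 1
  ext x
  constructor
  · rintro ⟨y, hy, rfl⟩
    exact ⟨_, hy, rfl⟩
  · rintro ⟨y, hy, hyx⟩
    have hx : x = goodMap e i y := by
      rw [← colorMap_colorMap e i x, ← hyx]; rfl
    exact ⟨goodMap e i y, by rwa [mem_preimage, goodMap_goodMap], hx.symm⟩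

theorem goodMap_injective {e : ℕ → Fin d × ℕ × (Label k × ℕ)}
    (he : ∀ q N, ∃ n, N ≤ n ∧ e n = q) (x : goodSet e) (i j : Fin d)
    (h : goodMap e i x = goodMap e j x) : i = j :=
  colorMap_injective he (isGood_coe e x) (congrArg Subtype.val h)

theorem integrable_extend {f : goodSet e → ℝ} (hf : Integrable f (goodMeasure e)) :
    Integrable (Function.extend Subtype.val f 0) (spaceMeasure k) := by
  rw [← map_goodMeasure e, (MeasurableEmbedding.subtype_coe
    (measurableSet_goodSet e)).integrable_map_iff, Function.extend_comp Subtype.val_injective]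
  exact hf

/-- The treeing. -/
noncomputable def goodGraphing [StandardBorelSpace (goodSet e)] : Graphing (goodSet e) :=
  involutionGraphing (goodMap_goodMap e) (goodMap_ne e) (goodMeasure e)
    (isProbabilityMeasure_goodMeasure e) (measurePreserving_goodMap e)

theorem isTreeing_goodGraphing {e : ℕ → Fin d × ℕ × (Label k × ℕ)}
    [StandardBorelSpace (goodSet e)]
    (he : ∀ q N, ∃ n, N ≤ n ∧ e n = q) : (goodGraphing e).IsTreeing :=
  Filter.Eventually.of_forall fun _ c =>
    isAcyclic_involutionGraph he Subtype.val_injective (isGood_coe e) (fun _ _ => rfl)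
      (goodMap_goodMap e) (goodMap_ne e) c

end Domain

/-! ### Circulations given by weights on the labels. -/

section Weights

variable {k d : ℕ}

/-- The function on the labels reversed by `flipLabel` with given values. -/
def labelWeight : (Fin k → ℝ) →ₗ[ℝ] Label k → ℝ where
  toFun a l := Fin.cases 0 a l.1 * if l.2 then 1 else -1
  map_add' a b := by
    funext ⟨j, t⟩
    induction j using Fin.cases <;> cases t <;> simp [add_comm]
  map_smul' c a := by
    funext ⟨j, t⟩
    induction j using Fin.cases <;> simp

theorem labelWeight_flipLabel (a : Fin k → ℝ) (l : Label k) :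
    labelWeight a (flipLabel l) = -labelWeight a l := by
  obtain ⟨j, t⟩ := l
  induction j using Fin.cases <;> cases t <;> simp [labelWeight, flipLabel]

theorem labelWeight_succ (a : Fin k → ℝ) (j : Fin k) : labelWeight a (j.succ, true) = a j := by
  simp [labelWeight]

/-- A label fixed by the flip gets the value zero, and every other pair of labels leaves one free
value. -/
theorem eq_labelWeight {γ : Label k → ℝ} (h : ∀ l, γ (flipLabel l) = -γ l) :
    γ = labelWeight fun j => γ (j.succ, true) := by
  funext ⟨j, t⟩
  induction j using Fin.cases with
  | zero =>
    have h1 : γ (0, t) = -γ (0, t) := h (0, t)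
    simp only [labelWeight, LinearMap.coe_mk, AddHom.coe_mk, Fin.cases_zero, zero_mul]
    linarith
  | succ j =>
    cases t with
    | true => rw [labelWeight_succ]
    | false =>
      have h1 := h (j.succ, true)
      have h2 := labelWeight_flipLabel (fun j => γ (j.succ, true)) (j.succ, true)
      have h3 : flipLabel (j.succ, true) = (j.succ, false) := by
        simp [flipLabel, Fin.succ_ne_zero]
      rw [h3] at h1 h2
      rw [h2, h1, labelWeight_succ]

variable (e : ℕ → Fin d × ℕ × (Label k × ℕ)) (i j : Fin d)

open Classical in
/-- The circulation that is constant up to sign on each label, along the edges of the colors `i`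
and `j`, and vanishes elsewhere. -/
noncomputable def labelFlow (a : Fin k → ℝ) (p : goodSet e × goodSet e) : ℝ :=
  if p.2 = goodMap e i p.1 then labelWeight a p.1.1.1
  else if p.2 = goodMap e j p.1 then -labelWeight a p.1.1.1 else 0

theorem labelFlow_add (a b : Fin k → ℝ) :
    labelFlow e i j (a + b) = labelFlow e i j a + labelFlow e i j b := by
  funext p
  simp only [labelFlow, map_add, Pi.add_apply]
  split_ifs <;> ring

theorem labelFlow_smul (c : ℝ) (a : Fin k → ℝ) :
    labelFlow e i j (c • a) = c • labelFlow e i j a := by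
  funext p
  simp only [labelFlow, map_smul, Pi.smul_apply, smul_eq_mul]
  split_ifs <;> ring

variable {e}

open Classical in
theorem labelFlow_goodMap (he : ∀ q N, ∃ n, N ≤ n ∧ e n = q) (a : Fin k → ℝ) (l : Fin d)
    (x : goodSet e) : labelFlow e i j a (x, goodMap e l x) =
      if l = i then labelWeight a x.1.1 else if l = j then -labelWeight a x.1.1 else 0 := by
  have h : ∀ m, goodMap e l x = goodMap e m x ↔ l = m :=
    fun m => ⟨goodMap_injective he x l m, fun h => h ▸ rfl⟩
  simp only [labelFlow, h]

variable {i j}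

theorem isCirculation_labelFlow (he : ∀ q N, ∃ n, N ≤ n ∧ e n = q) (hi : (i : ℕ) = 0)
    (hj : (j : ℕ) = 1) (a : Fin k → ℝ) :
    Graphing.IsCirculation (involutionGraph (goodMap e) (goodMap_goodMap e) (goodMap_ne e))
      fun x y => labelFlow e i j a (x, y) := by
  have hij : i ≠ j := by rintro rfl; omega
  refine (isCirculation_iff (goodMap_injective he)).2 ⟨fun l x => ?_, fun x => ?_⟩
  · have h := labelFlow_goodMap i j he a l (goodMap e l x)
    rw [goodMap_goodMap] at h
    rw [h, labelFlow_goodMap i j he a l x]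
    have hl : (l : ℕ) < 2 →
        labelWeight a (goodMap e l x).1.1 = -labelWeight a x.1.1 := fun hl => by
      rw [← labelWeight_flipLabel, ← colorMap_fst_of_lt_two e hl]; rfl
    split_ifs with h1 h2
    · rw [hl (by omega)]
    · rw [hl (by omega)]
    · simp
  · rw [Fintype.sum_eq_add i j hij]
    · rw [labelFlow_goodMap i j he, labelFlow_goodMap i j he, if_pos rfl, if_neg hij.symm,
        if_pos rfl, add_neg_cancel]
    · rintro l ⟨h1, h2⟩
      rw [labelFlow_goodMap i j he, if_neg h1, if_neg h2]

variable [StandardBorelSpace (goodSet e)]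

theorem measurable_labelFlow (a : Fin k → ℝ) : Measurable (labelFlow e i j a) := by
  classical
  have hw : Measurable fun p : goodSet e × goodSet e => labelWeight a p.1.1.1 :=
    (measurable_of_countable (labelWeight a)).comp
      (measurable_fst.comp (measurable_subtype_coe.comp measurable_fst))
  exact Measurable.ite (measurableSet_snd_eq (measurePreserving_goodMap e i).measurable) hw
    (Measurable.ite (measurableSet_snd_eq (measurePreserving_goodMap e j).measurable) hw.neg
      measurable_const)

theorem memLp_labelFlow (he : ∀ q N, ∃ n, N ≤ n ∧ e n = q) (hd : d ≠ 0) (a : Fin k → ℝ) :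
    MemLp (labelFlow e i j a) 2 ((goodGraphing e).edgeMeasure d) := by
  have : IsFiniteMeasure ((goodGraphing e).edgeMeasure d) :=
    isFiniteMeasure_edgeMeasure (goodMap_injective he) hd
  refine MemLp.of_bound (measurable_labelFlow a).aestronglyMeasurable
    (∑ l, ‖labelWeight a l‖) (Filter.Eventually.of_forall fun p => ?_)
  have h := Finset.single_le_sum (f := fun l => ‖labelWeight a l‖) (fun _ _ => norm_nonneg _)
    (Finset.mem_univ p.1.1.1)
  unfold labelFlow
  split_ifs
  · exact h
  · rw [norm_neg]; exact h
  · rw [norm_zero]; exact Finset.sum_nonneg fun _ _ => norm_nonneg _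

/-- The circulations constant up to sign on each label, as elements of the space of
square integrable circulations. -/
noncomputable def labelCirculation (he : ∀ q N, ∃ n, N ≤ n ∧ e n = q) (hd : d ≠ 0)
    (hi : (i : ℕ) = 0) (hj : (j : ℕ) = 1) :
    (Fin k → ℝ) →ₗ[ℝ] (goodGraphing e).circulations d where
  toFun a := ⟨(memLp_labelFlow he hd a).toLp (labelFlow e i j a),
    fun x y => labelFlow e i j a (x, y), isCirculation_labelFlow he hi hj a, MemLp.coeFn_toLp _⟩
  map_add' a b := Subtype.ext <| by
    have ha := memLp_labelFlow (i := i) (j := j) he hd a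
    have hb := memLp_labelFlow (i := i) (j := j) he hd b
    exact (MemLp.toLp_congr (memLp_labelFlow he hd (a + b)) (ha.add hb)
      (by rw [labelFlow_add])).trans (MemLp.toLp_add ha hb)
  map_smul' c a := Subtype.ext <| by
    have ha := memLp_labelFlow (i := i) (j := j) he hd a
    exact (MemLp.toLp_congr (memLp_labelFlow he hd (c • a)) (ha.const_smul c)
      (by rw [labelFlow_smul])).trans (MemLp.toLp_const_smul c ha)

theorem labelCirculation_injective (he : ∀ q N, ∃ n, N ≤ n ∧ e n = q) (hd : d ≠ 0)
    (hi : (i : ℕ) = 0) (hj : (j : ℕ) = 1) :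
    Function.Injective (labelCirculation (k := k) (i := i) (j := j) he hd hi hj) := by
  rw [injective_iff_map_eq_zero]
  intro a ha
  have h0 : (memLp_labelFlow he hd a).toLp (labelFlow e i j a) = 0 := congrArg Subtype.val ha
  have h1 : labelFlow e i j a =ᵐ[(goodGraphing e).edgeMeasure d] 0 :=
    (MemLp.coeFn_toLp (memLp_labelFlow he hd a)).symm.trans (by rw [h0]; exact Lp.coeFn_zero _ _ _)
  have h2 : ∀ᵐ x ∂goodMeasure e, labelWeight a x.1.1 = 0 := by
    filter_upwards [ae_of_ae_edgeMeasure (goodMap_injective he) h1 i] with x hx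
    rw [labelFlow_goodMap i j he, if_pos rfl] at hx
    exact hx
  rw [ae_goodMeasure_iff e (P := fun x => labelWeight a x.1 = 0)] at h2
  funext l
  by_contra hl
  -- The cell of level 0 consists of all points with this label and has positive measure.
  refine spaceMeasure_cell_ne_zero 0 ((l.succ, true), fun _ => 0) (measure_mono_null ?_ h2)
  intro x hx hx'
  change labelWeight a x.1 = 0 at hx'
  rw [(code_eq_iff.1 hx).1, labelWeight_succ] at hx'
  exact hl hx'

theorem labelCirculation_surjective (he : ∀ q N, ∃ n, N ≤ n ∧ e n = q) (hd : d ≠ 0)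
    (hi : (i : ℕ) = 0) (hj : (j : ℕ) = 1) :
    Function.Surjective (labelCirculation (k := k) (i := i) (j := j) he hd hi hj) := by
  rintro ⟨u, f, hf, hu⟩
  have hij : i ≠ j := by rintro rfl; omega
  have hcirc := (isCirculation_iff (hss := goodMap_goodMap e) (hne := goodMap_ne e)
    (goodMap_injective he)).1 hf
  have hfu := ae_of_ae_edgeMeasure (goodMap_injective he) hu
  have hfint : ∀ l, Integrable (fun x => f x (goodMap e l x)) (goodMeasure e) := fun l =>
    (integrable_of_memLp (goodMap_injective he) (Lp.memLp u) l).congr (hfu l)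
  -- Extension by zero off the good set, which is invariant, keeps antisymmetry and conservation
  -- valid at every point.
  let F : Fin d → Space k → ℝ := fun l =>
    Function.extend Subtype.val (fun x => f x (goodMap e l x)) 0
  have hFin : ∀ l (x : goodSet e), F l x = f x (goodMap e l x) :=
    fun l x => Subtype.val_injective.extend_apply _ _ x
  have hFout : ∀ l x, x ∉ goodSet e → F l x = 0 := fun l x hx =>
    Function.extend_apply' _ _ _ (by rintro ⟨y, rfl⟩; exact hx y.2)
  have hanti : ∀ l x, F l (colorMap e l x) = -F l x := by
    intro l x
    by_cases hx : x ∈ goodSet e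
    · have h1 := hFin l (goodMap e l ⟨x, hx⟩)
      rw [goodMap_goodMap, hcirc.1 l, ← hFin] at h1
      exact h1
    · have hx' : colorMap e l x ∉ goodSet e := fun h => hx (by
        have := colorMap_mem_goodSet e h l
        rwa [colorMap_colorMap] at this)
      rw [hFout l _ hx, hFout l _ hx', neg_zero]
  have hsum : ∀ x, ∑ l, F l x = 0 := by
    intro x
    by_cases hx : x ∈ goodSet e
    · exact (Finset.sum_congr rfl fun l _ => hFin l ⟨x, hx⟩).trans (hcirc.2 ⟨x, hx⟩)
    · exact Finset.sum_eq_zero fun l _ => hFout l x hx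
  obtain ⟨γ, hγ, h0, h1, h2⟩ := exists_label_of_circulation he
    (fun l => integrable_extend e (hfint l)) hanti hsum hi hj
  refine ⟨fun l => γ (l.succ, true), Subtype.ext (Lp.ext ?_)⟩
  refine (MemLp.coeFn_toLp (memLp_labelFlow he hd _)).trans ?_
  refine ae_edgeMeasure_of_forall (goodMap_injective he)
    (measurableSet_eq_fun (measurable_labelFlow _) (Lp.stronglyMeasurable u).measurable)
    fun l => ?_
  have hFl : ∀ᵐ x ∂spaceMeasure k,
      F l x = if l = i then γ x.1 else if l = j then -γ x.1 else 0 := by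
    split_ifs with hli hlj
    · rw [hli]; exact h0
    · rw [hlj]; exact h1
    · refine h2 l ?_
      by_contra h
      rcases (by omega : (l : ℕ) = 0 ∨ (l : ℕ) = 1) with h | h
      exacts [hli (Fin.ext (h.trans hi.symm)), hlj (Fin.ext (h.trans hj.symm))]
  filter_upwards [hfu l, (ae_goodMeasure_iff e).2 hFl] with x hx hx'
  rw [labelFlow_goodMap i j he, ← eq_labelWeight hγ, hx, ← hFin l x, hx']

end Weights

theorem theorem1 (d : ℕ) (hd : 3 ≤ d) (k : ℕ) :
    ∃ (X : Type) (_ : MeasurableSpace X) (_ : StandardBorelSpace X) (T : Graphing X),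
      T.IsRegular d ∧ T.IsTreeing ∧ Module.rank ℝ (T.circulations d) = (k : Cardinal) := by
  have : Nonempty (Fin d × ℕ × (Label k × ℕ)) := ⟨⟨0, by omega⟩, 0, (0, true), 0⟩
  obtain ⟨e, he⟩ := exists_recurrent_sequence (Fin d × ℕ × (Label k × ℕ))
  have hborel : StandardBorelSpace (goodSet e) := (measurableSet_goodSet e).standardBorel
  refine ⟨goodSet e, inferInstance, hborel, goodGraphing e,
    isRegular_involutionGraphing (goodMap_injective he), isTreeing_goodGraphing he, ?_⟩
  have hequiv := LinearEquiv.ofBijective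
    (labelCirculation (i := ⟨0, by omega⟩) (j := ⟨1, by omega⟩) he (by omega : d ≠ 0) rfl rfl)
    ⟨labelCirculation_injective he _ _ _, labelCirculation_surjective he _ _ _⟩
  rw [← hequiv.rank_eq, rank_fun', Fintype.card_fin]
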